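/- Let $d\ge 1$ be an integer, let $|x|$ be the Euclidean norm on $\mathbb{R}^d$, let $\mathcal{S}(\mathbb{R}^d)$ be the space of complex-valued Schwartz functions, and let $\hat f(\xi)=\int_{\mathbb{R}^d} e^{-2\pi i x\cdot\xi}f(x)\,dx$. For $1<p<\infty$ put $V_p(f)=\int_{\mathbb{R}^d}|x|^p|f(x)|^p\,dx$, $\|f\|_p^p=\int_{\mathbb{R}^d}|f(x)|^p\,dx$, and, for $f\in\mathcal{S}(\mathbb{R}^d)\setminus\{0\}$, $$Q_p(f)=\frac{V_p(f)}{\|f\|_p^p}\cdot\frac{V_p(\hat f)}{\|\hat f\|_p^p}.$$ Read $\frac{2d}{d-1}$ as $+\infty$ when $d=1$. (1) There are constants $C(d,p)>0$, one for each $d\ge1$ and each $p$ with $1<p<\frac{2d}{d-1}$, such that $Q_p(f)\ge C(d,p)$ for every $f\in\mathcal{S}(\mathbb{R}^d)\setminus\{0\}$. Moreover, they can be chosen so that for each fixed $p$ with $1<p\le 2$ there is a constant $C_1(p)>0$, independent of $d$, with $C(d,p)=C_1(p)\,d^p$ for all $d\ge 1$. Up to a dimension-free constant the growth $d^p$ is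 sharp: for each fixed $p$ with $1<p\le2$ there is $C_2(p)>0$, independent of $d$, such that for every $d\ge1$ the Gaussian $g(x)=e^{-\pi|x|^2}$ on $\mathbb{R}^d$ satisfies $Q_p(g)\le C_2(p)\,d^p$. (2) If $\frac{2d}{d-1}<p<\infty$, then $$\inf_{f\in\mathcal{S}(\mathbb{R}^d)\setminus\{0\}}Q_p(f)=0.$$ Moreover, the functions $g_c(x)=c^{-d/2}e^{-\pi|x|^2/c^2}+c^{d/2}e^{-\pi c^2|x|^2}$, $c>0$, are nonzero Schwartz functions with $\widehat{g_c}=g_c$, and $Q_p(g_c)\to0$ as $c\to\infty$. -/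

import Mathlib

open MeasureTheory Filter Topology FourierTransform SchwartzMap

noncomputable section

/-- The `p`-th moment `V_p(f) = ∫ |x|^p |f(x)|^p dx` over `ℝ^d`. -/
def moment {d : ℕ} (p : ℝ) (f : EuclideanSpace ℝ (Fin d) → ℂ) : ℝ :=
  ∫ x, ‖x‖ ^ p * ‖f x‖ ^ p

/-- `‖f‖_p^p = ∫ |f(x)|^p dx` over `ℝ^d`. -/
def lpPow {d : ℕ} (p : ℝ) (f : EuclideanSpace ℝ (Fin d) → ℂ) : ℝ :=
  ∫ x, ‖f x‖ ^ p

/-- The uncertainty product `(V_p(f) / ‖f‖_p^p) (V_p(f̂) / ‖f̂‖_p^p)` of a Schwartz function,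
with `f̂(ξ) = ∫ e^{-2πi x·ξ} f(x) dx`. -/
def uncertaintyProduct {d : ℕ} (p : ℝ) (f : 𝓢(EuclideanSpace ℝ (Fin d), ℂ)) : ℝ :=
  (moment p f / lpPow p f) *
    (moment p (𝓕 (f : EuclideanSpace ℝ (Fin d) → ℂ)) /
      lpPow p (𝓕 (f : EuclideanSpace ℝ (Fin d) → ℂ)))

/-- The function `g_c(x) = c^{-d/2} e^{-π|x|²/c²} + c^{d/2} e^{-πc²|x|²}` on `ℝ^d`. -/
def gaussianPair (d : ℕ) (c : ℝ) (x : EuclideanSpace ℝ (Fin d)) : ℝ :=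
  c ^ (-(d : ℝ) / 2) * Real.exp (-Real.pi * ‖x‖ ^ 2 / c ^ 2)
    + c ^ ((d : ℝ) / 2) * Real.exp (-Real.pi * c ^ 2 * ‖x‖ ^ 2)

end

/-! Let `R` and `S` be the `L^p` radii of `f` and `f̂`, with `R^p` and `S^p` proportional to
`V_p/‖·‖_p^p`, so that `Q_p` is a multiple of `(RS)^p`. Each lower bound for `p ≠ 2` bounds
`‖f̂‖_p/‖f‖_p` by a power of one radius. The same bound applied to `f̂` controls the inverse ratio
by the other radius; multiplying cancels the norms and bounds `RS` from below.

For `p < 2`, half of the mass of `f̂` lies in a ball `B` of radius `S`. Splitting `f` by height into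
an `L^1` part and an `L^2` part gives `∫_B |f̂|^p ≲ |B|^(2-p) ‖f‖_p^p`
(`setIntegral_fourier_rpow_le`). The bound `|B| ≤ (2πe S²/d)^(d/2)` then yields the factor `d^p`.
For `p = 2` this argument degenerates, and Heisenberg's inequality is summed over the coordinates
(`integral_norm_sq_le`).

For `p > 2`, a function supported in a ball of radius `r` satisfies `‖ĝ‖_p ≲ r^α ‖g‖_p` with `α =
d(1-2/p)`. The dyadic pieces of `f` at radius `2^k R` have norm `≲ 2^(-k) ‖f‖_p`, so the pieces of
`f̂` sum geometrically exactly when `α < 1`, that is `p(d-1) < 2d` (`exists_norm_toLp_fourier_le`).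

Beyond that threshold, `g_c` is its own transform. Its narrow Gaussian carries the `L^p` mass, while
the moment grows more slowly than that mass, so both factors of `Q_p` tend to zero. -/

/-! ### Integrability, positivity and Fourier symmetry. -/

section Basics

variable {d : ℕ} {p : ℝ}

lemma SchwartzMap.integrable_norm_rpow (f : 𝓢(EuclideanSpace ℝ (Fin d), ℂ)) (hp : 0 < p) :
    Integrable fun x => ‖f x‖ ^ p := by
  have h := (f.memLp (ENNReal.ofReal p)).integrable_norm_rpow (by simpa using hp) (by simp)
  simpa [ENNReal.toReal_ofReal hp.le] using h

lemma SchwartzMap.integrable_norm_sq (f : 𝓢(EuclideanSpace ℝ (Fin d), ℂ)) :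
    Integrable fun x => ‖f x‖ ^ 2 := by
  simpa using f.integrable_norm_rpow (p := 2) two_pos

/-- Since `‖x‖ ≤ 1 + ‖x‖²` and the right side is a smooth temperate weight, the integrand is
dominated by the `p`-th power of a Schwartz function. -/
lemma SchwartzMap.integrable_norm_rpow_mul (f : 𝓢(EuclideanSpace ℝ (Fin d), ℂ)) (hp : 0 < p) :
    Integrable fun x => ‖x‖ ^ p * ‖f x‖ ^ p := by
  have ht : Function.HasTemperateGrowth
      fun x : EuclideanSpace ℝ (Fin d) => (1 : ℝ) + ‖x‖ ^ 2 :=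
    (Function.HasTemperateGrowth.const 1).add (Function.hasTemperateGrowth_norm_sq _)
  refine ((smulLeftCLM ℂ (fun x : EuclideanSpace ℝ (Fin d) => (1 : ℝ) + ‖x‖ ^ 2)
    f).integrable_norm_rpow hp).mono' ?_ (ae_of_all _ fun x => ?_)
  · have : Continuous fun x => ‖x‖ ^ p * ‖f x‖ ^ p :=
      (continuous_norm.rpow_const fun _ => Or.inr hp.le).mul
        (f.continuous.norm.rpow_const fun _ => Or.inr hp.le)
    exact this.aestronglyMeasurable
  · rw [smulLeftCLM_apply_apply ht, norm_smul, Real.norm_of_nonneg (by positivity),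
      Real.norm_of_nonneg (by positivity), Real.mul_rpow (by positivity) (norm_nonneg _)]
    gcongr
    nlinarith [sq_nonneg (‖x‖ - 1), norm_nonneg x]

lemma lpPow_nonneg (f : EuclideanSpace ℝ (Fin d) → ℂ) : 0 ≤ lpPow p f :=
  integral_nonneg fun _ => by positivity

lemma moment_nonneg (f : EuclideanSpace ℝ (Fin d) → ℂ) : 0 ≤ moment p f :=
  integral_nonneg fun _ => by positivity

lemma SchwartzMap.exists_ne_zero {f : 𝓢(EuclideanSpace ℝ (Fin d), ℂ)} (hf : f ≠ 0) :
    ∃ x, f x ≠ 0 := by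
  by_contra! h
  exact hf (SchwartzMap.ext h)

lemma lpPow_pos {f : 𝓢(EuclideanSpace ℝ (Fin d), ℂ)} (hf : f ≠ 0) (hp : 0 < p) :
    0 < lpPow p f := by
  obtain ⟨x, hx⟩ := SchwartzMap.exists_ne_zero hf
  exact integral_pos_of_integrable_nonneg_nonzero (x := x)
    (f.continuous.norm.rpow_const fun _ => Or.inr hp.le) (f.integrable_norm_rpow hp)
    (fun _ => by positivity) (by positivity)

lemma moment_pos (hd : 1 ≤ d) {f : 𝓢(EuclideanSpace ℝ (Fin d), ℂ)} (hf : f ≠ 0) (hp : 0 < p) :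
    0 < moment p f := by
  have : Nontrivial (EuclideanSpace ℝ (Fin d)) :=
    Module.nontrivial_of_finrank_pos (R := ℝ) (by simpa using Nat.lt_of_succ_le hd)
  -- The weight vanishes at the origin, so a point of the open set `f ≠ 0` away from it is needed.
  obtain ⟨x, hx, hx0⟩ : ∃ x, f x ≠ 0 ∧ x ≠ 0 := by
    obtain ⟨x, hx0, hx⟩ := (dense_compl_singleton (0 : EuclideanSpace ℝ (Fin d))).inter_open_nonempty
      {x | f x ≠ 0} (isOpen_ne_fun f.continuous continuous_const) (SchwartzMap.exists_ne_zero hf)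
    exact ⟨x, hx0, hx⟩
  exact integral_pos_of_integrable_nonneg_nonzero (x := x)
    ((continuous_norm.rpow_const fun _ => Or.inr hp.le).mul
      (f.continuous.norm.rpow_const fun _ => Or.inr hp.le)) (f.integrable_norm_rpow_mul hp)
    (fun _ => by positivity) (by positivity)

/-- Reflection preserves moments and norms, so every bound for `(f, f̂)` also holds for `(f̂, f)`.
-/
lemma SchwartzMap.fourier_fourier_apply (f : 𝓢(EuclideanSpace ℝ (Fin d), ℂ))
    (x : EuclideanSpace ℝ (Fin d)) : 𝓕 (𝓕 f) x = f (-x) := by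
  have h : 𝓕⁻ (𝓕 f) (-x) = f (-x) := by rw [FourierTransform.fourierInv_fourier_eq]
  rw [← h, fourierInv_coe, Real.fourierInv_eq_fourier_neg, neg_neg, fourier_coe (𝓕 f)]

lemma lpPow_fourier_fourier (f : 𝓢(EuclideanSpace ℝ (Fin d), ℂ)) :
    lpPow p (𝓕 (𝓕 f) : 𝓢(EuclideanSpace ℝ (Fin d), ℂ)) = lpPow p f := by
  simp only [lpPow, SchwartzMap.fourier_fourier_apply]
  exact integral_neg_eq_self (fun x => ‖f x‖ ^ p) volume

lemma moment_fourier_fourier (f : 𝓢(EuclideanSpace ℝ (Fin d), ℂ)) :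
    moment p (𝓕 (𝓕 f) : 𝓢(EuclideanSpace ℝ (Fin d), ℂ)) = moment p f := by
  simp only [moment, SchwartzMap.fourier_fourier_apply]
  simpa using integral_neg_eq_self (fun x => ‖x‖ ^ p * ‖f x‖ ^ p) volume

lemma SchwartzMap.fourier_ne_zero {f : 𝓢(EuclideanSpace ℝ (Fin d), ℂ)} (hf : f ≠ 0) :
    𝓕 f ≠ 0 := by
  intro h
  apply hf
  ext x
  have h' := SchwartzMap.fourier_fourier_apply f (-x)
  rw [neg_neg, h] at h'
  rw [← h', fourier_coe, Real.fourier_eq]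
  simp

lemma SchwartzMap.norm_fourier_apply_le (f : 𝓢(EuclideanSpace ℝ (Fin d), ℂ))
    (ξ : EuclideanSpace ℝ (Fin d)) : ‖𝓕 f ξ‖ ≤ ∫ x, ‖f x‖ := by
  simpa [norm_toLp_one] using norm_fourier_apply_le_toLp_one f ξ

end Basics

/-! ### Splitting by height and the local mass of the transform, `p < 2`. -/

section LevelTruncation

variable {d : ℕ} {p : ℝ}

/-- Half of the `L^p` mass of `f` lies in the ball of radius `R` when `R^p = 2 V_p(f)/‖f‖_p^p`. -/
lemma lpPow_le_two_mul_setIntegral_closedBall (f : 𝓢(EuclideanSpace ℝ (Fin d), ℂ)) (hp : 0 < p)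
    {R : ℝ} (hR : 0 < R) (h : 2 * moment p f = R ^ p * lpPow p f) :
    lpPow p f ≤ 2 * ∫ x in Metric.closedBall 0 R, ‖f x‖ ^ p := by
  have hi := f.integrable_norm_rpow hp
  have hs : MeasurableSet (Metric.closedBall (0 : EuclideanSpace ℝ (Fin d)) R) :=
    Metric.isClosed_closedBall.measurableSet
  have hsplit := integral_add_compl hs hi
  have htail : R ^ p * ∫ x in (Metric.closedBall 0 R)ᶜ, ‖f x‖ ^ p ≤ moment p f := by
    rw [← integral_const_mul]
    refine (setIntegral_mono_on (hi.const_mul _).integrableOn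
      (f.integrable_norm_rpow_mul hp).integrableOn hs.compl fun x hx => ?_).trans
      (setIntegral_le_integral (f.integrable_norm_rpow_mul hp)
        (ae_of_all _ fun x => by positivity))
    have : R ≤ ‖x‖ := by
      simp only [Set.mem_compl_iff, mem_closedBall_zero_iff, not_le] at hx
      exact hx.le
    gcongr
  have hRp : 0 < R ^ p := Real.rpow_pos_of_pos hR p
  have : ∫ x in (Metric.closedBall 0 R)ᶜ, ‖f x‖ ^ p ≤ lpPow p f / 2 := by
    rw [← mul_le_mul_iff_right₀ hRp]
    linarith
  change _ = lpPow p f at hsplit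
  linarith

/-- A Schwartz function splits at height `l` into Schwartz functions `g` (high) and `h` (low). -/
lemma SchwartzMap.exists_level_decomposition (f : 𝓢(EuclideanSpace ℝ (Fin d), ℂ))
    {l : ℝ} (hl : 0 < l) :
    ∃ g h : 𝓢(EuclideanSpace ℝ (Fin d), ℂ), f = g + h ∧
      (∀ x, ‖g x‖ ≤ ‖f x‖ ∧ (‖f x‖ ≤ l → g x = 0)) ∧
      ∀ x, ‖h x‖ ≤ ‖f x‖ ∧ ‖h x‖ ≤ 2 * l := by
  -- The cutoff acts on the values of `f`, not on position. As `f` decays, `f (1 - χ ∘ f)` has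
  -- compact support and is therefore Schwartz.
  let χ : ContDiffBump (0 : ℂ) := ⟨l, 2 * l, hl, by linarith⟩
  have hc : HasCompactSupport fun x => f x * (1 - (χ (f x) : ℂ)) := by
    rw [hasCompactSupport_iff_eventuallyEq, coclosedCompact_eq_cocompact]
    filter_upwards [f.tendsto_cocompact.eventually (Metric.closedBall_mem_nhds 0 hl)] with x hx
    simp [χ.one_of_mem_closedBall hx]
  have hs : ContDiff ℝ (⊤ : ℕ∞) fun x => f x * (1 - (χ (f x) : ℂ)) :=
    (f.smooth ⊤).mul (contDiff_const.sub
      (Complex.ofRealCLM.contDiff.comp (χ.contDiff.comp (f.smooth ⊤))))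
  let g : 𝓢(EuclideanSpace ℝ (Fin d), ℂ) := hc.toSchwartzMap hs
  have hg : ∀ x, g x = f x * (1 - (χ (f x) : ℂ)) := fun x => rfl
  have hh : ∀ x, (f - g) x = f x * (χ (f x) : ℂ) := fun x => by
    rw [sub_apply, hg]; ring
  have h0 : ∀ x, 0 ≤ χ (f x) := fun x => χ.nonneg
  have h1 : ∀ x, χ (f x) ≤ 1 := fun x => χ.le_one
  refine ⟨g, f - g, by simp, fun x => ⟨?_, fun hx => ?_⟩, fun x => ?_⟩
  · rw [hg, norm_mul, ← Complex.ofReal_one, ← Complex.ofReal_sub, Complex.norm_real,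
      Real.norm_of_nonneg (by linarith [h1 x])]
    nlinarith [norm_nonneg (f x), h0 x]
  · rw [hg, χ.one_of_mem_closedBall (by simpa using hx)]
    simp
  · have : ‖(f - g) x‖ ≤ ‖f x‖ := by
      rw [hh, norm_mul, Complex.norm_real, Real.norm_of_nonneg (h0 x)]
      nlinarith [norm_nonneg (f x), h1 x]
    refine ⟨this, ?_⟩
    by_cases hx : ‖f x‖ ≤ 2 * l
    · exact this.trans hx
    · rw [hh, χ.zero_of_le_dist (by simpa using (not_le.1 hx).le)]
      simp [hl.le]

/-- Above the threshold `s`, `t^(p-2) ≤ s^(p-2)` because `p ≤ 2`. Integrated over a set of finite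
measure, this replaces Hölder's inequality from `L^2` to `L^p`. -/
lemma Real.rpow_le_rpow_add_rpow_mul_sq {s t p : ℝ} (hs : 0 < s) (ht : 0 ≤ t) (hp : 0 < p)
    (hp2 : p ≤ 2) : t ^ p ≤ s ^ p + s ^ (p - 2) * t ^ 2 := by
  rcases le_total t s with h | h
  · have := Real.rpow_le_rpow ht h hp.le
    have : 0 ≤ s ^ (p - 2) * t ^ 2 := by positivity
    linarith
  · have h0 : 0 < t := hs.trans_le h
    have h1 : t ^ p = t ^ (p - 2) * t ^ 2 := by
      rw [← Real.rpow_natCast, ← Real.rpow_add h0]; norm_num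
    have h2 : t ^ (p - 2) ≤ s ^ (p - 2) := Real.rpow_le_rpow_of_nonpos hs h (by linarith)
    rw [h1]
    have : 0 ≤ s ^ p := by positivity
    nlinarith [sq_nonneg t]

lemma Real.add_rpow_le_two_rpow_mul {a b p : ℝ} (ha : 0 ≤ a) (hb : 0 ≤ b) (hp : 0 < p) :
    (a + b) ^ p ≤ 2 ^ p * (a ^ p + b ^ p) := by
  wlog h : a ≤ b generalizing a b
  · rw [add_comm a b, add_comm (a ^ p)]
    exact this hb ha (not_le.1 h).le
  calc (a + b) ^ p ≤ (2 * b) ^ p := by gcongr; linarith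
    _ = 2 ^ p * b ^ p := Real.mul_rpow (by norm_num) hb
    _ ≤ _ := by
      gcongr
      exact le_add_of_nonneg_left (by positivity)

lemma Real.add_rpow_le_four_mul {a b p : ℝ} (ha : 0 ≤ a) (hb : 0 ≤ b) (hp : 0 < p) (hp2 : p ≤ 2) :
    (a + b) ^ p ≤ 4 * (a ^ p + b ^ p) := by
  refine (Real.add_rpow_le_two_rpow_mul ha hb hp).trans ?_
  gcongr
  calc (2 : ℝ) ^ p ≤ 2 ^ (2 : ℝ) := Real.rpow_le_rpow_of_exponent_le (by norm_num) hp2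
    _ = 4 := by norm_num

/-- The mass of `f̂` on a set of measure `v`. -/
lemma setIntegral_fourier_rpow_le (f : 𝓢(EuclideanSpace ℝ (Fin d), ℂ)) (hf : f ≠ 0) (hp : 1 < p)
    (hp2 : p < 2) {B : Set (EuclideanSpace ℝ (Fin d))} (hB' : volume B ≠ ⊤)
    (hv : 0 < volume.real B) :
    ∫ ξ in B, ‖𝓕 f ξ‖ ^ p ≤ 16 * volume.real B ^ (2 - p) * lpPow p f := by
  have hp0 : 0 < p := by linarith
  set v := volume.real B with hvdef
  set N := lpPow p f with hN
  have hNpos : 0 < N := lpPow_pos hf hp0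
  -- This height balances the two parts: both contribute a multiple of `v^(2-p) N`.
  obtain ⟨l, hl, hlp⟩ : ∃ l : ℝ, 0 < l ∧ l ^ p = N * v :=
    ⟨(N * v) ^ p⁻¹, by positivity, Real.rpow_inv_rpow (by positivity) hp0.ne'⟩
  obtain ⟨g, h, hfgh, hg, hh⟩ := f.exists_level_decomposition hl
  have hi := f.integrable_norm_rpow hp0
  have hgN : ∫ x, ‖g x‖ ≤ l ^ (1 - p) * N := by
    rw [hN, lpPow, ← integral_const_mul]
    refine integral_mono g.integrable.norm (hi.const_mul _) fun x => ?_
    rcases le_or_gt ‖f x‖ l with hx | hx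
    · have : 0 ≤ l ^ (1 - p) * ‖f x‖ ^ p := by positivity
      simpa [(hg x).2 hx] using this
    · have hx0 : 0 < ‖f x‖ := hl.trans hx
      refine (hg x).1.trans ?_
      calc ‖f x‖ = ‖f x‖ ^ (1 - p) * ‖f x‖ ^ p := by rw [← Real.rpow_add hx0]; simp
        _ ≤ l ^ (1 - p) * ‖f x‖ ^ p := by
          gcongr ?_ * _
          exact Real.rpow_le_rpow_of_nonpos hl hx.le (by linarith)
  have hhN : ∫ x, ‖h x‖ ^ 2 ≤ (2 * l) ^ (2 - p) * N := by
    rw [hN, lpPow, ← integral_const_mul]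
    refine integral_mono h.integrable_norm_sq (hi.const_mul _) fun x => ?_
    rcases (norm_nonneg (h x)).eq_or_lt with hx | hx
    · have : 0 ≤ (2 * l) ^ (2 - p) * ‖f x‖ ^ p := by positivity
      simpa [← hx] using this
    · calc ‖h x‖ ^ 2 = ‖h x‖ ^ (2 - p) * ‖h x‖ ^ p := by
            rw [← Real.rpow_add hx, ← Real.rpow_natCast]; norm_num
        _ ≤ (2 * l) ^ (2 - p) * ‖f x‖ ^ p := by
          have := (hh x).1
          have := (hh x).2
          have : 0 ≤ 2 - p := by linarith
          gcongr
  -- `s` equals the `L^1` bound for `g`, hence bounds `|ĝ|` everywhere; it also serves as the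
  -- threshold for `|ĥ|`.
  set s := l / v with hs
  have hspos : 0 < s := by positivity
  have hM : l ^ (1 - p) * N = s := by
    rw [Real.rpow_sub hl, hlp, Real.rpow_one, hs]; field_simp
  have key : ∀ ξ, ‖𝓕 f ξ‖ ^ p ≤ 8 * s ^ p + 4 * s ^ (p - 2) * ‖𝓕 h ξ‖ ^ 2 := fun ξ => by
    have h1 : ‖𝓕 g ξ‖ ^ p ≤ s ^ p := by
      gcongr
      exact (g.norm_fourier_apply_le ξ).trans (hgN.trans hM.le)
    have h2 := Real.rpow_le_rpow_add_rpow_mul_sq hspos (norm_nonneg (𝓕 h ξ)) hp0 hp2.le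
    calc ‖𝓕 f ξ‖ ^ p ≤ (‖𝓕 g ξ‖ + ‖𝓕 h ξ‖) ^ p := by
          gcongr
          rw [hfgh, FourierTransform.fourier_add, add_apply]
          exact norm_add_le _ _
      _ ≤ 4 * (‖𝓕 g ξ‖ ^ p + ‖𝓕 h ξ‖ ^ p) :=
        Real.add_rpow_le_four_mul (norm_nonneg _) (norm_nonneg _) hp0 hp2.le
      _ ≤ _ := by linarith
  have hint : ∫ ξ, ‖𝓕 h ξ‖ ^ 2 ≤ (2 * l) ^ (2 - p) * N := by
    rw [integral_norm_sq_fourier]; exact hhN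
  have hI := (𝓕 h).integrable_norm_sq
  have hI' : IntegrableOn (fun ξ => 4 * s ^ (p - 2) * ‖𝓕 h ξ‖ ^ 2) B :=
    (hI.const_mul _).integrableOn
  have hc : Integrable (fun _ => 8 * s ^ p) (volume.restrict B) := integrableOn_const hB'
  calc ∫ ξ in B, ‖𝓕 f ξ‖ ^ p
      ≤ ∫ ξ in B, (8 * s ^ p + 4 * s ^ (p - 2) * ‖𝓕 h ξ‖ ^ 2) :=
        integral_mono ((𝓕 f).integrable_norm_rpow hp0).integrableOn
          (hc.add hI') key
    _ = v * (8 * s ^ p) + 4 * s ^ (p - 2) * ∫ ξ in B, ‖𝓕 h ξ‖ ^ 2 := by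
        rw [integral_add hc hI', setIntegral_const, integral_const_mul, smul_eq_mul]
    _ ≤ v * (8 * s ^ p) + 4 * s ^ (p - 2) * ((2 * l) ^ (2 - p) * N) := by
        gcongr
        exact (setIntegral_le_integral hI (ae_of_all _ fun x => by positivity)).trans hint
    -- The constant is `8 + 4 · 2`, with `2^(2-p) ≤ 2` from `p > 1`.
    _ ≤ 16 * v ^ (2 - p) * N := by
        have e1 : v * s ^ p = v ^ (2 - p) * N := by
          rw [hs, Real.div_rpow hl.le hv.le, hlp, Real.rpow_sub hv, Real.rpow_two]; field_simp
        have e2 : s ^ (p - 2) * l ^ (2 - p) = v ^ (2 - p) := by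
          rw [hs, Real.div_rpow hl.le hv.le, ← neg_sub 2 p, Real.rpow_neg hl.le, Real.rpow_neg hv.le]
          field_simp
        have e3 : (2 : ℝ) ^ (2 - p) ≤ 2 := by
          calc (2 : ℝ) ^ (2 - p) ≤ 2 ^ (1 : ℝ) :=
                Real.rpow_le_rpow_of_exponent_le (by norm_num) (by linarith)
            _ = 2 := by norm_num
        have e4 : s ^ (p - 2) * ((2 * l) ^ (2 - p) * N) = 2 ^ (2 - p) * (v ^ (2 - p) * N) := by
          rw [Real.mul_rpow (by norm_num) hl.le, ← e2]; ring
        have e5 : 0 ≤ v ^ (2 - p) * N := by positivity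
        nlinarith

end LevelTruncation

/-! ### The lower bound for `1 < p < 2`, with growth `d^p`. -/

section SubquadraticExponent

variable {d : ℕ} {p : ℝ}

lemma uncertaintyProduct_eq (f : 𝓢(EuclideanSpace ℝ (Fin d), ℂ)) :
    uncertaintyProduct p f = (moment p f / lpPow p f) *
      (moment p (𝓕 f : 𝓢(EuclideanSpace ℝ (Fin d), ℂ)) /
        lpPow p (𝓕 f : 𝓢(EuclideanSpace ℝ (Fin d), ℂ))) := rfl

lemma uncertaintyProduct_nonneg (f : 𝓢(EuclideanSpace ℝ (Fin d), ℂ)) :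
    0 ≤ uncertaintyProduct p f :=
  mul_nonneg (div_nonneg (moment_nonneg _) (lpPow_nonneg _))
    (div_nonneg (moment_nonneg _) (lpPow_nonneg _))

lemma integrable_exp_neg_mul_norm_sq {b : ℝ} (hb : 0 < b) :
    Integrable fun x : EuclideanSpace ℝ (Fin d) => Real.exp (-b * ‖x‖ ^ 2) := by
  have h := (GaussianFourier.integrable_cexp_neg_mul_sq_norm_add (V := EuclideanSpace ℝ (Fin d))
    (b := (b : ℂ)) (by simpa using hb) 0 0).norm
  refine h.congr (ae_of_all _ fun x => ?_)
  simp only [Complex.norm_exp]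
  congr 1
  simp [← Complex.ofReal_pow]

/-- A Chernoff bound: `e^(-bR²) |B| ≤ ∫ e^(-b|x|²) = (π/b)^(d/2)`, with the optimal `b = d/(2R²)`.
The resulting decay `d^(-d/2)` is what produces the dimensional growth. -/
lemma volume_real_closedBall_le (hd : 1 ≤ d) {R : ℝ} (hR : 0 < R) :
    volume.real (Metric.closedBall (0 : EuclideanSpace ℝ (Fin d)) R) ≤
      (2 * Real.pi * Real.exp 1 / d * R ^ 2) ^ ((d : ℝ) / 2) := by
  have hd0 : (0 : ℝ) < d := by exact_mod_cast hd
  set b : ℝ := d / (2 * R ^ 2) with hb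
  have hbpos : 0 < b := by positivity
  have hi := integrable_exp_neg_mul_norm_sq (d := d) hbpos
  have h1 : Real.exp (-(d / 2)) * volume.real (Metric.closedBall (0 : EuclideanSpace ℝ (Fin d)) R) ≤
      (Real.pi / b) ^ ((d : ℝ) / 2) := by
    have hI := GaussianFourier.integral_rexp_neg_mul_sq_norm (V := EuclideanSpace ℝ (Fin d)) hbpos
    rw [finrank_euclideanSpace_fin] at hI
    rw [← hI, mul_comm, ← smul_eq_mul, ← setIntegral_const]
    refine le_trans ?_ (setIntegral_le_integral (s := Metric.closedBall 0 R) hi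
      (ae_of_all _ fun x => (Real.exp_pos _).le))
    refine setIntegral_mono_on (integrableOn_const
      (isCompact_closedBall _ _).measure_lt_top.ne) hi.integrableOn
      Metric.isClosed_closedBall.measurableSet fun x hx => ?_
    rw [mem_closedBall_zero_iff] at hx
    apply Real.exp_le_exp.2
    have : b * ‖x‖ ^ 2 ≤ b * R ^ 2 := by gcongr
    have : b * R ^ 2 = d / 2 := by rw [hb]; field_simp
    linarith
  have h2 : Real.exp (d / 2) = Real.exp 1 ^ ((d : ℝ) / 2) := by
    rw [← Real.exp_mul, one_mul]
  calc _ = Real.exp (d / 2) * (Real.exp (-(d / 2)) *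
        volume.real (Metric.closedBall (0 : EuclideanSpace ℝ (Fin d)) R)) := by
        rw [← mul_assoc, ← Real.exp_add]; simp
    _ ≤ Real.exp (d / 2) * (Real.pi / b) ^ ((d : ℝ) / 2) := by gcongr
    _ = _ := by
      rw [h2, ← Real.mul_rpow (by positivity) (by positivity), hb]
      congr 1
      field_simp

lemma lpPow_fourier_le_of_radius (hd : 1 ≤ d) {f : 𝓢(EuclideanSpace ℝ (Fin d), ℂ)} (hf : f ≠ 0)
    (hp : 1 < p) (hp2 : p < 2) {S : ℝ} (hS : 0 < S)
    (h : 2 * moment p (𝓕 f : 𝓢(EuclideanSpace ℝ (Fin d), ℂ)) =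
      S ^ p * lpPow p (𝓕 f : 𝓢(EuclideanSpace ℝ (Fin d), ℂ))) :
    lpPow p (𝓕 f : 𝓢(EuclideanSpace ℝ (Fin d), ℂ)) ≤
      32 * ((2 * Real.pi * Real.exp 1 / d * S ^ 2) ^ ((d : ℝ) / 2)) ^ (2 - p) * lpPow p f := by
  have h1 := lpPow_le_two_mul_setIntegral_closedBall (𝓕 f) (by linarith) hS h
  have h2 := setIntegral_fourier_rpow_le f hf hp hp2 (B := Metric.closedBall 0 S)
    (isCompact_closedBall _ _).measure_lt_top.ne
    (by
      rw [measureReal_def]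
      exact ENNReal.toReal_pos (Metric.measure_closedBall_pos _ _ hS).ne'
        (isCompact_closedBall _ _).measure_lt_top.ne)
  have h3 : volume.real (Metric.closedBall (0 : EuclideanSpace ℝ (Fin d)) S) ^ (2 - p) ≤
      ((2 * Real.pi * Real.exp 1 / d * S ^ 2) ^ ((d : ℝ) / 2)) ^ (2 - p) :=
    Real.rpow_le_rpow measureReal_nonneg (volume_real_closedBall_le hd hS) (by linarith)
  have h4 := mul_le_mul_of_nonneg_right h3 (lpPow_nonneg (p := p) f)
  nlinarith

lemma exists_radius {M N p : ℝ} (hM : 0 < M) (hN : 0 < N) (hp : 0 < p) :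
    ∃ R : ℝ, 0 < R ∧ M = R ^ p * N :=
  ⟨(M / N) ^ p⁻¹, by positivity, by
    rw [Real.rpow_inv_rpow (by positivity) hp.ne']; field_simp⟩

theorem uncertaintyProduct_ge_of_lt_two (hd : 1 ≤ d) (hp : 1 < p) (hp2 : p < 2)
    {f : 𝓢(EuclideanSpace ℝ (Fin d), ℂ)} (hf : f ≠ 0) :
    (((1 / 1024) ^ (2 - p)⁻¹ / (2 * Real.pi * Real.exp 1)) ^ p / 4) * (d : ℝ) ^ p ≤
      uncertaintyProduct p f := by
  have hp0 : 0 < p := by linarith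
  have hq : 0 < 2 - p := by linarith
  have hd1 : (1 : ℝ) ≤ d := by exact_mod_cast hd
  have hd0 : (0 : ℝ) < d := by linarith
  have hF := SchwartzMap.fourier_ne_zero hf
  have hN := lpPow_pos hf hp0
  have hN' := lpPow_pos hF hp0
  obtain ⟨R, hR, hRp⟩ := exists_radius (mul_pos two_pos (moment_pos hd hf hp0)) hN hp0
  obtain ⟨S, hS, hSp⟩ := exists_radius (mul_pos two_pos (moment_pos hd hF hp0)) hN' hp0
  have h1 := lpPow_fourier_le_of_radius hd hf hp hp2 hS hSp
  have h2 := lpPow_fourier_le_of_radius hd hF hp hp2 hR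
    (by rwa [lpPow_fourier_fourier, moment_fourier_fourier])
  rw [lpPow_fourier_fourier] at h2
  set a : ℝ := 2 * Real.pi * Real.exp 1 with ha
  have hapos : 0 < a := by positivity
  have hprod : ((a / d * S ^ 2) ^ ((d : ℝ) / 2)) ^ (2 - p) * ((a / d * R ^ 2) ^ ((d : ℝ) / 2)) ^ (2 - p)
      = ((a / d * (R * S)) ^ (2 - p)) ^ (d : ℝ) := by
    rw [← Real.mul_rpow (by positivity) (by positivity),
      ← Real.mul_rpow (by positivity) (by positivity),
      show a / d * S ^ 2 * (a / d * R ^ 2) = (a / d * (R * S)) ^ (2 : ℝ) by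
        rw [Real.rpow_two]; ring,
      ← Real.rpow_mul (by positivity), ← Real.rpow_mul (by positivity),
      ← Real.rpow_mul (by positivity)]
    congr 1
    ring
  set X := ((a / d * S ^ 2) ^ ((d : ℝ) / 2)) ^ (2 - p)
  set Y := ((a / d * R ^ 2) ^ ((d : ℝ) / 2)) ^ (2 - p)
  set N := lpPow p f
  set N' := lpPow p (𝓕 f : 𝓢(EuclideanSpace ℝ (Fin d), ℂ))
  have hX : 0 ≤ X := by positivity
  have hY : 0 ≤ Y := by positivity
  have h3 : 1 ≤ 1024 * (X * Y) := by
    have : N ≤ 32 * Y * (32 * X * N) := h2.trans (by gcongr)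
    have : 1 * N ≤ 1024 * (X * Y) * N := by linarith
    exact le_of_mul_le_mul_right this hN
  rw [hprod] at h3
  -- A base in `[0, 1]` only shrinks under the power `d ≥ 1`, so the base itself must be at least
  -- `1/1024`. This keeps the constant free of `d`.
  have h4 : (1 / 1024) ^ (2 - p)⁻¹ ≤ a / d * (R * S) := by
    by_contra! hlt
    have h5 : (a / d * (R * S)) ^ (2 - p) < 1 / 1024 := by
      calc _ < ((1 / 1024 : ℝ) ^ (2 - p)⁻¹) ^ (2 - p) := by gcongr
        _ = 1 / 1024 := Real.rpow_inv_rpow (by norm_num) hq.ne'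
    have h6 : ((a / d * (R * S)) ^ (2 - p)) ^ (d : ℝ) ≤ (a / d * (R * S)) ^ (2 - p) := by
      calc _ ≤ ((a / d * (R * S)) ^ (2 - p)) ^ (1 : ℝ) :=
            Real.rpow_le_rpow_of_exponent_ge (by positivity) (by linarith) hd1
        _ = _ := Real.rpow_one _
    linarith
  have h7 : (1 / 1024) ^ (2 - p)⁻¹ / a * d ≤ R * S := by
    rw [div_mul_eq_mul_div, div_le_iff₀ hapos]
    calc _ ≤ a / d * (R * S) * d := by gcongr
      _ = R * S * a := by field_simp
  -- The radii were normalized by twice the moments, whence the `4`.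
  have h8 : uncertaintyProduct p f = (R * S) ^ p / 4 := by
    change moment p f / N * (moment p (𝓕 f : 𝓢(EuclideanSpace ℝ (Fin d), ℂ)) / N') = _
    rw [show moment p f = R ^ p * N / 2 by linarith,
      show moment p (𝓕 f : 𝓢(EuclideanSpace ℝ (Fin d), ℂ)) = S ^ p * N' / 2 by linarith,
      Real.mul_rpow hR.le hS.le]
    field_simp
    try norm_num
  rw [h8, div_mul_eq_mul_div, ← Real.mul_rpow (by positivity) hd0.le]
  gcongr

end SubquadraticExponent

/-! ### The case `p = 2`: Heisenberg's inequality. -/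

section Heisenberg

open scoped LineDeriv

variable {d : ℕ}

lemma moment_two_eq_sum (f : 𝓢(EuclideanSpace ℝ (Fin d), ℂ)) :
    moment 2 f = ∑ i, ∫ x : EuclideanSpace ℝ (Fin d), x i ^ 2 * ‖f x‖ ^ 2 := by
  have hi : ∀ i ∈ Finset.univ, Integrable
      fun x : EuclideanSpace ℝ (Fin d) => x i ^ 2 * ‖f x‖ ^ 2 := fun i _ => by
    refine (f.integrable_norm_rpow_mul (p := 2) two_pos).mono'
      (by fun_prop) (ae_of_all _ fun x => ?_)
    rw [Real.norm_of_nonneg (by positivity), Real.rpow_two, Real.rpow_two]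
    have : x i ^ 2 ≤ ‖x‖ ^ 2 := by
      rw [← sq_abs, ← Real.norm_eq_abs]
      gcongr
      exact PiLp.norm_apply_le x i
    gcongr
  rw [← integral_finsetSum _ hi, moment]
  congr 1 with x
  rw [Real.rpow_two, Real.rpow_two, EuclideanSpace.real_norm_sq_eq, Finset.sum_mul]

lemma integral_norm_sq_lineDerivOp (f : 𝓢(EuclideanSpace ℝ (Fin d), ℂ)) (i : Fin d) :
    ∫ x, ‖(∂_{EuclideanSpace.single i (1 : ℝ)} f : 𝓢(EuclideanSpace ℝ (Fin d), ℂ)) x‖ ^ 2 =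
      4 * Real.pi ^ 2 * ∫ ξ : EuclideanSpace ℝ (Fin d), ξ i ^ 2 * ‖𝓕 f ξ‖ ^ 2 := by
  rw [← integral_norm_sq_fourier, ← integral_const_mul]
  congr 1 with ξ
  rw [fourier_lineDerivOp_eq, smul_apply, smulLeftCLM_apply_apply
    (Function.hasTemperateGrowth_inner_left _), norm_smul, norm_smul]
  simp [EuclideanSpace.inner_single_right, mul_pow, abs_of_pos Real.pi_pos]
  left
  norm_num

/-- Integration by parts gives `∫ |f|² = -2 ∫ ⟨x_i f, ∂_i f⟩` for the real inner product; the
weighted arithmetic-geometric inequality does the rest. Leaving `t` free allows one optimization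
after summing over `i`. -/
lemma integral_norm_sq_le (f : 𝓢(EuclideanSpace ℝ (Fin d), ℂ)) (i : Fin d) {t : ℝ} (ht : 0 < t) :
    ∫ x, ‖f x‖ ^ 2 ≤ t * (∫ x : EuclideanSpace ℝ (Fin d), x i ^ 2 * ‖f x‖ ^ 2) +
      t⁻¹ * ∫ x, ‖(∂_{EuclideanSpace.single i (1 : ℝ)} f : 𝓢(EuclideanSpace ℝ (Fin d), ℂ)) x‖ ^ 2 := by
  set e : EuclideanSpace ℝ (Fin d) := EuclideanSpace.single i (1 : ℝ) with he
  have hT : Function.HasTemperateGrowth fun x : EuclideanSpace ℝ (Fin d) => inner ℝ x e :=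
    Function.hasTemperateGrowth_inner_left e
  set g := smulLeftCLM ℂ (fun x : EuclideanSpace ℝ (Fin d) => inner ℝ x e) f with hg
  have hgx : ∀ x, g x = (x i : ℂ) * f x := fun x => by
    rw [hg, smulLeftCLM_apply_apply hT, he, EuclideanSpace.inner_single_right]
    simp
  have hdg : ∀ x, (∂_{e} g) x = f x + (x i : ℂ) * (∂_{e} f) x := fun x => by
    have h1 : HasFDerivAt (fun x : EuclideanSpace ℝ (Fin d) => (x i : ℂ) * f x) _ x :=
      (Complex.ofRealCLM.comp (EuclideanSpace.proj i)).hasFDerivAt.mul (f.hasFDerivAt x)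
    rw [lineDerivOp_apply_eq_fderiv, show (g : EuclideanSpace ℝ (Fin d) → ℂ) = _ from funext hgx,
      h1.fderiv, lineDerivOp_apply_eq_fderiv]
    simp [he, add_comm]
  have hparts : ∫ x, inner ℝ (g x) ((∂_{e} f) x) = -∫ x, inner ℝ ((∂_{e} g) x) (f x) :=
    integral_bilinear_lineDerivOp_right_eq_neg_left g f (innerSL ℝ) e
  set h : 𝓢(EuclideanSpace ℝ (Fin d), ℂ) := ∂_{e} f with hh
  have hgi : Integrable fun x : EuclideanSpace ℝ (Fin d) => x i ^ 2 * ‖f x‖ ^ 2 :=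
    g.integrable_norm_sq.congr (ae_of_all _ fun x => by simp [hgx, mul_pow])
  have hbound : ∀ x, 2 * |inner ℝ (g x) (h x)| ≤ t * (x i ^ 2 * ‖f x‖ ^ 2) + t⁻¹ * ‖h x‖ ^ 2 := by
    intro x
    have h1 := abs_real_inner_le_norm (g x) (h x)
    have h2 : x i ^ 2 * ‖f x‖ ^ 2 = ‖g x‖ ^ 2 := by simp [hgx, mul_pow]
    have h3 : t * ‖g x‖ ^ 2 + t⁻¹ * ‖h x‖ ^ 2 - 2 * (‖g x‖ * ‖h x‖) =
        t⁻¹ * (t * ‖g x‖ - ‖h x‖) ^ 2 := by field_simp; ring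
    have h4 : 0 ≤ t⁻¹ * (t * ‖g x‖ - ‖h x‖) ^ 2 := by positivity
    rw [h2]
    linarith
  have hbi : Integrable fun x : EuclideanSpace ℝ (Fin d) =>
      t * (x i ^ 2 * ‖f x‖ ^ 2) + t⁻¹ * ‖h x‖ ^ 2 :=
    (hgi.const_mul t).add (h.integrable_norm_sq.const_mul t⁻¹)
  have hii : Integrable fun x => inner ℝ (g x) (h x) :=
    hbi.mono' (g.continuous.inner h.continuous).aestronglyMeasurable
      (ae_of_all _ fun x => by
        rw [Real.norm_eq_abs]
        linarith [hbound x, abs_nonneg (inner ℝ (g x) (h x))])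
  have hpt : ∀ x, inner ℝ ((∂_{e} g) x) (f x) = ‖f x‖ ^ 2 + inner ℝ (g x) (h x) := fun x => by
    rw [hdg, inner_add_left, real_inner_self_eq_norm_sq, hgx, ← Complex.real_smul,
      ← Complex.real_smul, real_inner_smul_left, real_inner_smul_left, real_inner_comm]
  simp only [hpt] at hparts
  rw [integral_add f.integrable_norm_sq hii] at hparts
  calc ∫ x, ‖f x‖ ^ 2 = ∫ x, -2 * inner ℝ (g x) (h x) := by
        rw [integral_const_mul]; linarith
    _ ≤ ∫ x : EuclideanSpace ℝ (Fin d), (t * (x i ^ 2 * ‖f x‖ ^ 2) + t⁻¹ * ‖h x‖ ^ 2) :=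
        integral_mono (hii.const_mul _) hbi fun x => by
          have := neg_abs_le (inner ℝ (g x) (h x))
          have := hbound x
          simp only
          linarith
    _ = _ := by
        rw [integral_add (hgi.const_mul t) (h.integrable_norm_sq.const_mul t⁻¹),
          integral_const_mul, integral_const_mul]

theorem uncertaintyProduct_two_ge (hd : 1 ≤ d) {f : 𝓢(EuclideanSpace ℝ (Fin d), ℂ)} (hf : f ≠ 0) :
    1 / (16 * Real.pi ^ 2) * (d : ℝ) ^ (2 : ℝ) ≤ uncertaintyProduct 2 f := by
  have hF := SchwartzMap.fourier_ne_zero hf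
  have hN := lpPow_pos hf two_pos
  have hV := moment_pos hd hf two_pos
  have hV' := moment_pos hd hF two_pos
  have hNeq : lpPow 2 f = ∫ x, ‖f x‖ ^ 2 := by simp [lpPow]
  have hPl : lpPow 2 (𝓕 f : 𝓢(EuclideanSpace ℝ (Fin d), ℂ)) = lpPow 2 f := by
    simpa [lpPow] using integral_norm_sq_fourier f
  have key : ∀ t : ℝ, 0 < t → d * lpPow 2 f ≤ t * moment 2 f +
      t⁻¹ * (4 * Real.pi ^ 2 * moment 2 (𝓕 f : 𝓢(EuclideanSpace ℝ (Fin d), ℂ))) := fun t ht => by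
    have h := Finset.sum_le_sum fun (i : Fin d) (_ : i ∈ Finset.univ) => integral_norm_sq_le f i ht
    simp only [integral_norm_sq_lineDerivOp, Finset.sum_add_distrib, ← Finset.mul_sum,
      ← moment_two_eq_sum] at h
    simpa [hNeq] using h
  rw [uncertaintyProduct_eq, hPl]
  set V := moment 2 f
  set V' := moment 2 (𝓕 f : 𝓢(EuclideanSpace ℝ (Fin d), ℂ))
  set N := lpPow 2 f
  -- This `t` makes the two terms equal, hence minimizes their sum.
  have h := key (2 * Real.pi * √V' / √V) (by positivity)
  have hs : √V ^ 2 = V := Real.sq_sqrt hV.le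
  have hs' : √V' ^ 2 = V' := Real.sq_sqrt hV'.le
  have h1 : d * N ≤ 4 * Real.pi * (√V * √V') := by
    refine h.trans_eq ?_
    rw [← hs, ← hs', Real.sqrt_sq (Real.sqrt_nonneg _), Real.sqrt_sq (Real.sqrt_nonneg _)]
    have : 0 < √V := Real.sqrt_pos.2 hV
    have : 0 < √V' := Real.sqrt_pos.2 hV'
    field_simp
    ring
  have h2 : (d * N) ^ 2 ≤ 16 * Real.pi ^ 2 * (V * V') := by
    calc (d * N) ^ 2 ≤ (4 * Real.pi * (√V * √V')) ^ 2 := by gcongr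
      _ = 16 * Real.pi ^ 2 * (√V ^ 2 * √V' ^ 2) := by ring
      _ = _ := by rw [hs, hs']
  rw [Real.rpow_two, div_mul_div_comm, le_div_iff₀ (by positivity), div_mul_eq_mul_div, one_mul,
    div_mul_eq_mul_div, div_le_iff₀ (by positivity)]
  linarith

end Heisenberg

/-! ### Fourier bounds for functions of bounded support, `p > 2`. -/

section DyadicDecomposition

variable {d : ℕ} {p : ℝ}

lemma Real.pow_le_add_rpow_mul_rpow {s t p : ℝ} (hs : 0 < s) (ht : 0 ≤ t) {k : ℕ}
    (hp : k ≤ p) : t ^ k ≤ s ^ k + s ^ (k - p) * t ^ p := by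
  rcases le_or_gt t s with h | h
  · have h1 : t ^ k ≤ s ^ k := by gcongr
    have h2 : 0 ≤ s ^ (k - p) * t ^ p := by positivity
    linarith
  · have h0 : 0 < t := hs.trans h
    have h1 : t ^ k = t ^ (k - p) * t ^ p := by
      rw [← Real.rpow_natCast, ← Real.rpow_add h0]; simp
    have h2 : t ^ (k - p) ≤ s ^ (k - p) := Real.rpow_le_rpow_of_nonpos hs h.le (by linarith)
    have h3 : t ^ (k - p) * t ^ p ≤ s ^ (k - p) * t ^ p := by gcongr
    have h4 : 0 ≤ s ^ k := by positivity
    linarith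

/-- Here `s` is the `L^p` average of `g` over `B`. Comparing `‖g‖` with `s` pointwise gives Hölder's
inequality up to a factor `2`; it is used for `k = 1` and `k = 2`. -/
lemma integral_norm_pow_le_of_support (g : 𝓢(EuclideanSpace ℝ (Fin d), ℂ))
    {B : Set (EuclideanSpace ℝ (Fin d))} (hB : volume B ≠ ⊤)
    (hg : ∀ x ∉ B, g x = 0) {k : ℕ} (hk : 1 ≤ k) (hp : k ≤ p) {s : ℝ} (hs : 0 < s)
    (hsp : s ^ p * volume.real B = lpPow p g) :
    ∫ x, ‖g x‖ ^ k ≤ 2 * volume.real B * s ^ k := by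
  have hk0 : k ≠ 0 := by omega
  have hp0 : 0 < p := by
    have : (1 : ℝ) ≤ k := by exact_mod_cast hk
    linarith
  have hi := g.integrable_norm_rpow hp0
  have hik : Integrable fun x => ‖g x‖ ^ k := by
    simpa using g.integrable_norm_rpow (p := k) (by positivity)
  have h1 : ∫ x, ‖g x‖ ^ k = ∫ x in B, ‖g x‖ ^ k := by
    rw [setIntegral_eq_integral_of_forall_compl_eq_zero]
    intro x hx
    simp [hg x hx, hk0]
  have hc : Integrable (fun _ => s ^ k) (volume.restrict B) := integrableOn_const hB
  have hiB : Integrable (fun x => s ^ (k - p) * ‖g x‖ ^ p) (volume.restrict B) :=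
    (hi.const_mul _).integrableOn
  have h2 : ∫ x in B, ‖g x‖ ^ p ≤ lpPow p g :=
    setIntegral_le_integral hi (ae_of_all _ fun x => by positivity)
  calc ∫ x, ‖g x‖ ^ k = ∫ x in B, ‖g x‖ ^ k := h1
    _ ≤ ∫ x in B, (s ^ k + s ^ (k - p) * ‖g x‖ ^ p) :=
      integral_mono hik.integrableOn (hc.add hiB) fun x =>
        Real.pow_le_add_rpow_mul_rpow hs (norm_nonneg _) hp
    _ = volume.real B * s ^ k + s ^ (k - p) * ∫ x in B, ‖g x‖ ^ p := by
      rw [integral_add hc hiB, setIntegral_const, integral_const_mul, smul_eq_mul]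
    _ ≤ volume.real B * s ^ k + s ^ (k - p) * lpPow p g := by gcongr
    _ = _ := by
      rw [← hsp, ← mul_assoc, ← Real.rpow_add hs, sub_add_cancel, Real.rpow_natCast]
      ring

/-- Interpolation by hand: `|ĝ|^p ≤ ‖g‖_1^(p-2) |ĝ|²`, then Plancherel, with the `L^1` and `L^2`
norms controlled through the support. -/
lemma lpPow_fourier_le_of_support (g : 𝓢(EuclideanSpace ℝ (Fin d), ℂ)) (hp : 2 < p)
    {B : Set (EuclideanSpace ℝ (Fin d))} (hB : volume B ≠ ⊤)
    (hv : 0 < volume.real B) (hg : ∀ x ∉ B, g x = 0) :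
    lpPow p (𝓕 g : 𝓢(EuclideanSpace ℝ (Fin d), ℂ)) ≤
      2 ^ (p - 1) * volume.real B ^ (p - 2) * lpPow p g := by
  have hp0 : 0 < p := by linarith
  rcases eq_or_ne g 0 with rfl | hg0
  · have h0 : (𝓕 (0 : 𝓢(EuclideanSpace ℝ (Fin d), ℂ))) = 0 := by
      ext ξ
      rw [fourier_coe, Real.fourier_eq]
      simp
    rw [h0]
    simp [lpPow, hp0.ne']
  set v := volume.real B with hvdef
  obtain ⟨s, hs, hsp⟩ := exists_radius (lpPow_pos hg0 hp0) hv hp0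
  have h1 : ∫ x, ‖g x‖ ≤ 2 * v * s := by
    simpa using integral_norm_pow_le_of_support g hB hg le_rfl (by simp; linarith) hs hsp.symm
  have h2 : ∫ x, ‖g x‖ ^ 2 ≤ 2 * v * s ^ 2 :=
    integral_norm_pow_le_of_support g hB hg one_le_two (by simpa using hp.le) hs hsp.symm
  have h3 : ∀ ξ, ‖𝓕 g ξ‖ ^ p ≤ (2 * v * s) ^ (p - 2) * ‖𝓕 g ξ‖ ^ 2 := fun ξ => by
    rcases (norm_nonneg (𝓕 g ξ)).eq_or_lt with h | h
    · simp [← h, hp0.ne']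
    · have h4 : ‖𝓕 g ξ‖ ^ p = ‖𝓕 g ξ‖ ^ (p - 2) * ‖𝓕 g ξ‖ ^ 2 := by
        rw [← Real.rpow_natCast, ← Real.rpow_add h]; simp
      rw [h4]
      have h5 := (g.norm_fourier_apply_le ξ).trans h1
      have : 0 ≤ p - 2 := by linarith
      gcongr
  calc lpPow p (𝓕 g : 𝓢(EuclideanSpace ℝ (Fin d), ℂ))
      ≤ ∫ ξ, (2 * v * s) ^ (p - 2) * ‖𝓕 g ξ‖ ^ 2 :=
        integral_mono ((𝓕 g).integrable_norm_rpow hp0) ((𝓕 g).integrable_norm_sq.const_mul _) h3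
    _ ≤ (2 * v * s) ^ (p - 2) * (2 * v * s ^ 2) := by
        rw [integral_const_mul, integral_norm_sq_fourier]
        gcongr
    _ = _ := by
        rw [hsp, Real.mul_rpow (by positivity) hs.le, Real.mul_rpow (by positivity) hv.le,
          Real.rpow_sub hs, Real.rpow_two, show p - 1 = p - 2 + 1 by ring,
          Real.rpow_add two_pos, Real.rpow_one]
        field_simp

lemma norm_toLp_eq_lpPow (hp : 0 < p) (f : 𝓢(EuclideanSpace ℝ (Fin d), ℂ)) :
    ‖f.toLp (ENNReal.ofReal p)‖ = lpPow p f ^ p⁻¹ := by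
  rw [norm_toLp' (by simpa using hp) (by simp), ENNReal.toReal_ofReal hp.le, lpPow]

/-- For functions supported in a ball of radius `r`, the norm of the Fourier transform on `L^p`
is `O(r^{d(1-2/p)})`. -/
lemma exists_norm_toLp_fourier_le_of_support (d : ℕ) (hp : 2 < p) :
    ∃ K : ℝ, 0 < K ∧ ∀ (g : 𝓢(EuclideanSpace ℝ (Fin d), ℂ)) (r : ℝ), 0 < r →
      (∀ x, r < ‖x‖ → g x = 0) →
      ‖(𝓕 g).toLp (ENNReal.ofReal p)‖ ≤
        K * r ^ (d * (1 - 2 / p)) * ‖g.toLp (ENNReal.ofReal p)‖ := by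
  have hp0 : 0 < p := by linarith
  have hω : 0 < volume.real (Metric.closedBall (0 : EuclideanSpace ℝ (Fin d)) 1) := by
    rw [measureReal_def]
    exact ENNReal.toReal_pos (Metric.measure_closedBall_pos _ _ one_pos).ne'
      (isCompact_closedBall _ _).measure_lt_top.ne
  set ω := volume.real (Metric.closedBall (0 : EuclideanSpace ℝ (Fin d)) 1)
  refine ⟨(2 ^ (p - 1) * ω ^ (p - 2)) ^ p⁻¹, by positivity, fun g r hr hg => ?_⟩
  have hvol : volume.real (Metric.closedBall (0 : EuclideanSpace ℝ (Fin d)) r) = r ^ (d : ℝ) * ω := by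
    rw [Measure.addHaar_real_closedBall' _ _ hr.le]
    simp [ω]
  have h := lpPow_fourier_le_of_support g hp (B := Metric.closedBall 0 r)
    (isCompact_closedBall _ _).measure_lt_top.ne
    (by rw [hvol]; positivity) (fun x hx => hg x (by simpa using hx))
  rw [norm_toLp_eq_lpPow hp0, norm_toLp_eq_lpPow hp0]
  calc _ ≤ (2 ^ (p - 1) * volume.real (Metric.closedBall (0 : EuclideanSpace ℝ (Fin d)) r) ^ (p - 2)
        * lpPow p g) ^ p⁻¹ := by
        gcongr
        exact lpPow_nonneg _
    _ = _ := by
        have h1 := lpPow_nonneg (p := p) (g : EuclideanSpace ℝ (Fin d) → ℂ)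
        rw [hvol, Real.mul_rpow (by positivity) h1, Real.mul_rpow (by positivity) hω.le,
          mul_left_comm, mul_comm, Real.mul_rpow (by positivity) (by positivity),
          ← Real.rpow_mul hr.le, ← Real.rpow_mul hr.le]
        have : (d : ℝ) * (p - 2) * p⁻¹ = d * (1 - 2 / p) := by field_simp
        rw [this]
        ring

end DyadicDecomposition

/-! ### Dyadic summation and the lower bound for `2 < p`, `p(d-1) < 2d`. -/

section SuperquadraticExponent

variable {d : ℕ} {p : ℝ}

/-- A smooth bump equal to `1` on the ball of radius `2^k R`, supported in the ball of radius
`2^(k+1) R`. -/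
noncomputable def dyadicBump (d : ℕ) {R : ℝ} (hR : 0 < R) (k : ℕ) :
    ContDiffBump (0 : EuclideanSpace ℝ (Fin d)) :=
  ⟨2 ^ k * R, 2 ^ (k + 1) * R, by positivity, by
    have : 0 < 2 ^ k * R := by positivity
    rw [pow_succ]; linarith⟩

/-- The truncation of a Schwartz function to a dyadic ball. -/
noncomputable def dyadicTruncation {R : ℝ} (hR : 0 < R) (f : 𝓢(EuclideanSpace ℝ (Fin d), ℂ)) (k : ℕ) :
    𝓢(EuclideanSpace ℝ (Fin d), ℂ) :=
  smulLeftCLM ℂ (fun x => dyadicBump d hR k x) f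

lemma dyadicTruncation_apply {R : ℝ} (hR : 0 < R) (f : 𝓢(EuclideanSpace ℝ (Fin d), ℂ)) (k : ℕ)
    (x : EuclideanSpace ℝ (Fin d)) :
    dyadicTruncation hR f k x = dyadicBump d hR k x • f x :=
  smulLeftCLM_apply_apply
    ((dyadicBump d hR k).hasCompactSupport.hasTemperateGrowth (dyadicBump d hR k).contDiff) f x

lemma dyadicBump_eq_one {R : ℝ} (hR : 0 < R) (k : ℕ) {x : EuclideanSpace ℝ (Fin d)}
    (hx : ‖x‖ ≤ 2 ^ k * R) : dyadicBump d hR k x = 1 :=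
  (dyadicBump d hR k).one_of_mem_closedBall (by simpa [dyadicBump] using hx)

lemma dyadicBump_eq_zero {R : ℝ} (hR : 0 < R) (k : ℕ) {x : EuclideanSpace ℝ (Fin d)}
    (hx : 2 ^ (k + 1) * R ≤ ‖x‖) : dyadicBump d hR k x = 0 :=
  (dyadicBump d hR k).zero_of_le_dist (by simpa [dyadicBump] using hx)

lemma norm_dyadicTruncation_le {R : ℝ} (hR : 0 < R) (f : 𝓢(EuclideanSpace ℝ (Fin d), ℂ)) (k : ℕ)
    (x : EuclideanSpace ℝ (Fin d)) : ‖dyadicTruncation hR f k x‖ ≤ ‖f x‖ := by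
  rw [dyadicTruncation_apply, norm_smul, Real.norm_of_nonneg (dyadicBump d hR k).nonneg]
  exact mul_le_of_le_one_left (norm_nonneg _) (dyadicBump d hR k).le_one

lemma norm_toLp_dyadicTruncation_le (hp : 0 < p) {R : ℝ} (hR : 0 < R)
    (f : 𝓢(EuclideanSpace ℝ (Fin d), ℂ)) (k : ℕ) :
    ‖(dyadicTruncation hR f k).toLp (ENNReal.ofReal p)‖ ≤ ‖f.toLp (ENNReal.ofReal p)‖ := by
  rw [norm_toLp_eq_lpPow hp, norm_toLp_eq_lpPow hp]
  refine Real.rpow_le_rpow (lpPow_nonneg _) (integral_mono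
    (SchwartzMap.integrable_norm_rpow _ hp) (f.integrable_norm_rpow hp) fun x => ?_) (by positivity)
  have := norm_dyadicTruncation_le hR f k x
  dsimp only
  gcongr

/-- The difference vanishes for `‖x‖ ≤ 2^k R`, and elsewhere `1 ≤ ‖x‖/(2^k R)` brings in the moment
weight. -/
lemma norm_toLp_dyadicTruncation_sub_le (hp : 0 < p) {R : ℝ} (hR : 0 < R)
    (f : 𝓢(EuclideanSpace ℝ (Fin d), ℂ)) (k : ℕ) :
    ‖(dyadicTruncation hR f (k + 1) - dyadicTruncation hR f k).toLp (ENNReal.ofReal p)‖ ≤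
      (2 ^ k * R)⁻¹ * moment p f ^ p⁻¹ := by
  have hk : 0 < 2 ^ k * R := by positivity
  have hM := moment_nonneg (p := p) (f : EuclideanSpace ℝ (Fin d) → ℂ)
  rw [norm_toLp_eq_lpPow hp]
  have h : lpPow p (dyadicTruncation hR f (k + 1) - dyadicTruncation hR f k) ≤
      ((2 ^ k * R)⁻¹) ^ p * moment p f := by
    rw [lpPow, moment, ← integral_const_mul]
    refine integral_mono (SchwartzMap.integrable_norm_rpow _ hp)
      ((f.integrable_norm_rpow_mul hp).const_mul _) fun x => ?_
    dsimp only
    rw [← Real.mul_rpow (norm_nonneg _) (norm_nonneg _),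
      ← Real.mul_rpow (by positivity) (by positivity)]
    refine Real.rpow_le_rpow (norm_nonneg _) ?_ hp.le
    rw [sub_apply, dyadicTruncation_apply, dyadicTruncation_apply, ← sub_smul, norm_smul]
    rcases le_or_gt ‖x‖ (2 ^ k * R) with hx | hx
    · rw [dyadicBump_eq_one hR k hx, dyadicBump_eq_one hR (k + 1)
        (hx.trans (by rw [pow_succ]; linarith))]
      simp only [sub_self, norm_zero, zero_mul]
      positivity
    · rw [← mul_assoc]
      gcongr
      have h1 : 1 ≤ (2 ^ k * R)⁻¹ * ‖x‖ := by
        rw [← div_eq_inv_mul, le_div_iff₀ hk]; linarith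
      refine le_trans ?_ h1
      rw [Real.norm_eq_abs, abs_le]
      have h2 := (dyadicBump d hR k).nonneg (x := x)
      have h3 := (dyadicBump d hR k).le_one (x := x)
      have h4 := (dyadicBump d hR (k + 1)).nonneg (x := x)
      have h5 := (dyadicBump d hR (k + 1)).le_one (x := x)
      constructor <;> linarith
  calc _ ≤ (((2 ^ k * R)⁻¹) ^ p * moment p f) ^ p⁻¹ :=
        Real.rpow_le_rpow (lpPow_nonneg _) h (by positivity)
    _ = _ := by
      rw [Real.mul_rpow (by positivity) hM, Real.rpow_rpow_inv (by positivity) hp.ne']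

lemma tendsto_fourier_dyadicTruncation {R : ℝ} (hR : 0 < R)
    (f : 𝓢(EuclideanSpace ℝ (Fin d), ℂ)) (ξ : EuclideanSpace ℝ (Fin d)) :
    Tendsto (fun k => 𝓕 (dyadicTruncation hR f k) ξ) atTop (𝓝 (𝓕 f ξ)) := by
  simp only [fourier_coe, Real.fourier_eq]
  refine tendsto_integral_of_dominated_convergence (fun x => ‖f x‖) (fun k => ?_)
    f.integrable.norm (fun k => ae_of_all _ fun x => ?_) (ae_of_all _ fun x => ?_)
  · exact ((Real.fourierIntegral_convergent_iff ξ).2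
      (dyadicTruncation hR f k).integrable).aestronglyMeasurable
  · rw [Circle.norm_smul]
    exact norm_dyadicTruncation_le hR f k x
  · refine tendsto_const_nhds.congr' ?_
    have h : Tendsto (fun k : ℕ => (2 : ℝ) ^ k * R) atTop atTop :=
      (tendsto_pow_atTop_atTop_of_one_lt one_lt_two).atTop_mul_const hR
    filter_upwards [h.eventually_ge_atTop ‖x‖] with k hk
    rw [dyadicTruncation_apply, dyadicBump_eq_one hR k hk, one_smul]

/-- Fatou's lemma: pointwise convergence of the transforms suffices, with no convergence in `L^p`.
-/
lemma toReal_eLpNorm_le_of_tendsto {α : Type*} [MeasurableSpace α] {μ : Measure α}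
    {F : ℕ → α → ℂ} {G : α → ℂ} {q : ENNReal} {C : ℝ} (hF : ∀ k, MemLp (F k) q μ)
    (hlim : ∀ x, Tendsto (fun k => F k x) atTop (𝓝 (G x)))
    (h : ∀ k, (eLpNorm (F k) q μ).toReal ≤ C) : (eLpNorm G q μ).toReal ≤ C := by
  have hC : 0 ≤ C := ENNReal.toReal_nonneg.trans (h 0)
  have hle : ∀ k, eLpNorm (F k) q μ ≤ ENNReal.ofReal C := fun k =>
    (ENNReal.le_ofReal_iff_toReal_le (hF k).eLpNorm_ne_top hC).2 (h k)
  refine ENNReal.toReal_le_of_le_ofReal hC ((Lp.eLpNorm_lim_le_liminf_eLpNorm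
    (fun k => (hF k).aestronglyMeasurable) _ (ae_of_all _ hlim)).trans ?_)
  refine liminf_le_of_le (by isBoundedDefault) fun b hb => ?_
  obtain ⟨k, hk⟩ := hb.exists
  exact hk.trans (hle k)

lemma norm_toLp_fourier_le_of_dyadicTruncation {R : ℝ} (hR : 0 < R)
    (f : 𝓢(EuclideanSpace ℝ (Fin d), ℂ)) (q : ENNReal) {C : ℝ}
    (h : ∀ k, ‖(𝓕 (dyadicTruncation hR f k)).toLp q‖ ≤ C) : ‖(𝓕 f).toLp q‖ ≤ C := by
  simp only [norm_toLp] at h ⊢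
  exact toReal_eLpNorm_le_of_tendsto (fun k => SchwartzMap.memLp (𝓕 (dyadicTruncation hR f k)) q)
    (tendsto_fourier_dyadicTruncation hR f) h

lemma exists_norm_toLp_fourier_le (d : ℕ) (hp : 2 < p) (hpd : p * ((d : ℝ) - 1) < 2 * d) :
    ∃ D : ℝ, 0 < D ∧ ∀ (f : 𝓢(EuclideanSpace ℝ (Fin d), ℂ)) (R : ℝ), 0 < R →
      moment p f = R ^ p * lpPow p f →
      ‖(𝓕 f).toLp (ENNReal.ofReal p)‖ ≤
        D * R ^ (d * (1 - 2 / p)) * ‖f.toLp (ENNReal.ofReal p)‖ := by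
  have hp0 : 0 < p := by linarith
  have : Fact (1 ≤ ENNReal.ofReal p) := ⟨by simpa using (by linarith : (1 : ℝ) ≤ p)⟩
  obtain ⟨K, hK, hbound⟩ := exists_norm_toLp_fourier_le_of_support d hp
  set α : ℝ := d * (1 - 2 / p) with hα
  have hα0 : 0 ≤ α := by
    have : 2 / p ≤ 1 := (div_le_one hp0).2 hp.le
    have : 0 ≤ 1 - 2 / p := by linarith
    positivity
  have hα1 : α < 1 := by
    have : α * p < 1 * p := by
      rw [hα]
      field_simp
      linarith
    exact lt_of_mul_lt_mul_right this hp0.le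
  -- The ratio of the series: `2^α` from the growing support against `2^(-1)` from the moment decay.
  set q : ℝ := 2 ^ (α - 1) with hq
  have hq0 : 0 < q := by positivity
  have hq1 : q < 1 := Real.rpow_lt_one_of_one_lt_of_neg one_lt_two (by linarith)
  refine ⟨K * 4 ^ α * (1 + (1 - q)⁻¹), by
    have : 0 < 1 - q := by linarith
    positivity, fun f R hR hRp => ?_⟩
  have hM : moment p f ^ p⁻¹ = R * ‖f.toLp (ENNReal.ofReal p)‖ := by
    rw [hRp, Real.mul_rpow (by positivity) (lpPow_nonneg _), Real.rpow_rpow_inv hR.le hp0.ne',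
      norm_toLp_eq_lpPow hp0]
  set n := ‖f.toLp (ENNReal.ofReal p)‖ with hn
  have hn0 : 0 ≤ n := norm_nonneg _
  have key : ∀ m : ℕ, ‖(𝓕 (dyadicTruncation hR f m)).toLp (ENNReal.ofReal p)‖ ≤
      K * 4 ^ α * R ^ α * n * (1 + ∑ k ∈ Finset.range m, q ^ k) := by
    intro m
    induction m with
    | zero =>
      have h := hbound (dyadicTruncation hR f 0) (2 * R) (by positivity) fun x hx => by
        rw [dyadicTruncation_apply, dyadicBump_eq_zero hR 0 (by simpa using hx.le), zero_smul]
      refine h.trans ?_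
      rw [Finset.range_zero, Finset.sum_empty, add_zero, mul_one,
        Real.mul_rpow two_pos.le hR.le, ← mul_assoc]
      have := norm_toLp_dyadicTruncation_le hp0 hR f 0
      gcongr
      norm_num
    | succ m ih =>
      set g := dyadicTruncation hR f (m + 1) - dyadicTruncation hR f m with hg
      have h1 : ‖(𝓕 (dyadicTruncation hR f (m + 1))).toLp (ENNReal.ofReal p)‖ ≤
          ‖(𝓕 (dyadicTruncation hR f m)).toLp (ENNReal.ofReal p)‖ +
          ‖(𝓕 g).toLp (ENNReal.ofReal p)‖ := by
        have : dyadicTruncation hR f (m + 1) = dyadicTruncation hR f m + g := by rw [hg]; abel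
        rw [this, FourierTransform.fourier_add]
        have h := (toLpCLM ℂ ℂ (ENNReal.ofReal p)
          (volume : Measure (EuclideanSpace ℝ (Fin d)))).map_add
          (𝓕 (dyadicTruncation hR f m)) (𝓕 g)
        exact (congrArg norm h).le.trans (norm_add_le _ _)
      -- The outer radius of bump `m + 1` is `2^(m+2) R`, whence the factor `4^α`.
      have h2 := hbound g (2 ^ (m + 2) * R) (by positivity) fun x hx => by
        rw [hg, sub_apply, dyadicTruncation_apply, dyadicTruncation_apply,
          dyadicBump_eq_zero hR (m + 1) hx.le, dyadicBump_eq_zero hR m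
            (le_trans (by gcongr <;> norm_num) hx.le)]
        simp
      have h3 := norm_toLp_dyadicTruncation_sub_le hp0 hR f m
      rw [hM, ← hg] at h3
      have h4 : K * (2 ^ (m + 2) * R) ^ α * ((2 ^ m * R)⁻¹ * (R * n)) =
          K * 4 ^ α * R ^ α * n * q ^ m := by
        have e1 : ((2 : ℝ) ^ (m + 2)) ^ α = 4 ^ α * (2 ^ α) ^ m := by
          rw [pow_add, Real.mul_rpow (by positivity) (by positivity), ← Real.rpow_natCast (2 ^ α),
            ← Real.rpow_mul two_pos.le, mul_comm α, Real.rpow_mul two_pos.le, Real.rpow_natCast]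
          norm_num
          ring
        rw [Real.mul_rpow (by positivity) hR.le, e1, hq, Real.rpow_sub_one two_ne_zero, div_pow]
        field_simp
      rw [Finset.sum_range_succ]
      have h5 : ‖(𝓕 g).toLp (ENNReal.ofReal p)‖ ≤ K * 4 ^ α * R ^ α * n * q ^ m := by
        rw [← h4]
        refine h2.trans ?_
        gcongr
      linarith
  refine norm_toLp_fourier_le_of_dyadicTruncation hR f _ fun m => (key m).trans ?_
  have hsum : ∑ k ∈ Finset.range m, q ^ k ≤ (1 - q)⁻¹ := by
    rw [← tsum_geometric_of_lt_one hq0.le hq1]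
    exact (summable_geometric_of_lt_one hq0.le hq1).sum_le_tsum _ fun _ _ => by positivity
  calc _ ≤ K * 4 ^ α * R ^ α * n * (1 + (1 - q)⁻¹) := by gcongr
    _ = _ := by ring

theorem exists_uncertaintyProduct_ge_of_two_lt (hd : 1 ≤ d) (hp : 2 < p)
    (hpd : p * ((d : ℝ) - 1) < 2 * d) :
    ∃ C : ℝ, 0 < C ∧ ∀ f : 𝓢(EuclideanSpace ℝ (Fin d), ℂ), f ≠ 0 →
      C ≤ uncertaintyProduct p f := by
  have hp0 : 0 < p := by linarith
  obtain ⟨D, hD, hbound⟩ := exists_norm_toLp_fourier_le d hp hpd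
  set α : ℝ := d * (1 - 2 / p) with hα
  have hα0 : 0 < α := by
    have : 2 / p < 1 := (div_lt_one hp0).2 hp
    have : 0 < 1 - 2 / p := by linarith
    have : (0 : ℝ) < d := by exact_mod_cast hd
    positivity
  refine ⟨((D ^ 2)⁻¹ ^ α⁻¹) ^ p, by positivity, fun f hf => ?_⟩
  have hF := SchwartzMap.fourier_ne_zero hf
  have hN := lpPow_pos hf hp0
  have hN' := lpPow_pos hF hp0
  obtain ⟨R, hR, hRp⟩ := exists_radius (moment_pos hd hf hp0) hN hp0
  obtain ⟨S, hS, hSp⟩ := exists_radius (moment_pos hd hF hp0) hN' hp0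
  have h1 := hbound f R hR hRp
  have h2 := hbound (𝓕 f) S hS hSp
  rw [norm_toLp_eq_lpPow hp0, norm_toLp_eq_lpPow hp0] at h1 h2
  rw [lpPow_fourier_fourier] at h2
  have hU : uncertaintyProduct p f = (R * S) ^ p := by
    rw [uncertaintyProduct_eq, hRp, hSp, Real.mul_rpow hR.le hS.le]
    field_simp
  rw [hU]
  set n := lpPow p f ^ p⁻¹
  set n' := lpPow p (𝓕 f : 𝓢(EuclideanSpace ℝ (Fin d), ℂ)) ^ p⁻¹
  have hn : 0 < n := by positivity
  -- The bounds for `f` and `f̂` are chained, and the norm of `f` cancels.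
  have h3 : 1 ≤ D ^ 2 * (R * S) ^ α := by
    have : n ≤ D * S ^ α * (D * R ^ α * n) := h2.trans (by gcongr)
    have : 1 * n ≤ D ^ 2 * (R * S) ^ α * n := by
      rw [Real.mul_rpow hR.le hS.le]; linarith
    exact le_of_mul_le_mul_right this hn
  have h4 : (D ^ 2)⁻¹ ≤ (R * S) ^ α := by
    rw [inv_le_iff_one_le_mul₀ (by positivity)]; linarith
  refine Real.rpow_le_rpow (by positivity) ?_ hp0.le
  calc (D ^ 2)⁻¹ ^ α⁻¹ ≤ ((R * S) ^ α) ^ α⁻¹ := by gcongr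
    _ = R * S := Real.rpow_rpow_inv (by positivity) hα0.ne'

end SuperquadraticExponent

/-! ### Gaussians as Schwartz functions and the sharpness of `d^p`. -/

section Gaussian

variable {d : ℕ} {p : ℝ}

/-- The bound for derivatives of a composition gives a polynomial times the Gaussian. The polynomial
is absorbed by `e^(1+‖x‖)`, and `r - b r² ≤ 1/(4b)`. -/
lemma gaussian_decay {b : ℝ} (hb : 0 < b) (k n : ℕ) :
    ∃ C : ℝ, ∀ x : EuclideanSpace ℝ (Fin d),
      ‖x‖ ^ k * ‖iteratedFDeriv ℝ n (fun x => Real.exp (-b * ‖x‖ ^ 2)) x‖ ≤ C := by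
  have hT : Function.HasTemperateGrowth fun x : EuclideanSpace ℝ (Fin d) => -b * ‖x‖ ^ 2 :=
    (Function.HasTemperateGrowth.const (-b)).mul (Function.hasTemperateGrowth_norm_sq _)
  obtain ⟨m, C, hC, h⟩ := hT.norm_iteratedFDeriv_le_uniform n
  refine ⟨n.factorial * (1 + C) ^ n * ((k + m * n).factorial * Real.exp (1 + 1 / (4 * b))),
    fun x => ?_⟩
  have h1 : 1 ≤ 1 + ‖x‖ := by linarith [norm_nonneg x]
  have hD1 : 1 ≤ (1 + C) * (1 + ‖x‖) ^ m :=
    one_le_mul_of_one_le_of_one_le (by linarith) (one_le_pow₀ h1)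
  have hcomp : ‖iteratedFDeriv ℝ n (fun x => Real.exp (-b * ‖x‖ ^ 2)) x‖ ≤
      n.factorial * Real.exp (-b * ‖x‖ ^ 2) * ((1 + C) * (1 + ‖x‖) ^ m) ^ n := by
    refine norm_iteratedFDeriv_comp_le (g := Real.exp) (N := n) Real.contDiff_exp
      (hT.1.of_le (by exact_mod_cast le_top)) le_rfl x (fun i _ => ?_) fun i hi hin => ?_
    · rw [norm_iteratedFDeriv_eq_norm_iteratedDeriv, iteratedDeriv_eq_iterate, Real.iter_deriv_exp,
        Real.norm_of_nonneg (Real.exp_pos _).le]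
    · refine (h i hin x).trans ((?_ : _ ≤ (1 + C) * (1 + ‖x‖) ^ m).trans
        (le_self_pow₀ hD1 (by omega)))
      gcongr
      linarith
  have h2 : ‖x‖ ^ k * ((1 + ‖x‖) ^ m) ^ n ≤ (k + m * n).factorial * Real.exp (1 + ‖x‖) := by
    have := Real.pow_div_factorial_le_exp (1 + ‖x‖) (by positivity) (k + m * n)
    rw [div_le_iff₀ (by positivity)] at this
    calc _ ≤ (1 + ‖x‖) ^ k * ((1 + ‖x‖) ^ m) ^ n := by gcongr; linarith
      _ = (1 + ‖x‖) ^ (k + m * n) := by rw [pow_add, pow_mul]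
      _ ≤ _ := by linarith
  have h3 : Real.exp (1 + ‖x‖) * Real.exp (-b * ‖x‖ ^ 2) ≤ Real.exp (1 + 1 / (4 * b)) := by
    rw [← Real.exp_add]
    apply Real.exp_le_exp.2
    have : 1 / (4 * b) - (‖x‖ - b * ‖x‖ ^ 2) = b * (‖x‖ - 1 / (2 * b)) ^ 2 := by
      field_simp; ring
    have : 0 ≤ b * (‖x‖ - 1 / (2 * b)) ^ 2 := by positivity
    linarith
  calc _ ≤ ‖x‖ ^ k * (n.factorial * Real.exp (-b * ‖x‖ ^ 2) * ((1 + C) * (1 + ‖x‖) ^ m) ^ n) := by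
        gcongr
    _ = n.factorial * (1 + C) ^ n * ((‖x‖ ^ k * ((1 + ‖x‖) ^ m) ^ n) * Real.exp (-b * ‖x‖ ^ 2)) := by
        rw [mul_pow]; ring
    _ ≤ n.factorial * (1 + C) ^ n *
        (((k + m * n).factorial * Real.exp (1 + ‖x‖)) * Real.exp (-b * ‖x‖ ^ 2)) := by gcongr
    _ = n.factorial * (1 + C) ^ n *
        ((k + m * n).factorial * (Real.exp (1 + ‖x‖) * Real.exp (-b * ‖x‖ ^ 2))) := by ring
    _ ≤ _ := by gcongr

/-- The Gaussian `exp(-b|x|²)` as a Schwartz function (zero unless `b > 0`). -/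
noncomputable def schwartzGaussian (d : ℕ) (b : ℝ) : 𝓢(EuclideanSpace ℝ (Fin d), ℂ) :=
  if hb : 0 < b then
    postcompCLM Complex.ofRealCLM
      { toFun := fun x => Real.exp (-b * ‖x‖ ^ 2)
        smooth' := (contDiff_const.mul (contDiff_norm_sq ℝ)).exp
        decay' := gaussian_decay hb }
  else 0

lemma schwartzGaussian_apply {b : ℝ} (hb : 0 < b) (x : EuclideanSpace ℝ (Fin d)) :
    schwartzGaussian d b x = (Real.exp (-b * ‖x‖ ^ 2) : ℝ) := by
  simp only [schwartzGaussian, hb, dite_true]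
  rfl

lemma fourier_schwartzGaussian {b : ℝ} (hb : 0 < b) :
    𝓕 (schwartzGaussian d b) =
      (((Real.pi / b) ^ ((d : ℝ) / 2) : ℝ) : ℂ) • schwartzGaussian d (Real.pi ^ 2 / b) := by
  ext ξ
  have h := fourier_gaussian_innerProductSpace (V := EuclideanSpace ℝ (Fin d)) (b := (b : ℂ))
    (by simpa using hb) ξ
  have hfun : (schwartzGaussian d b : EuclideanSpace ℝ (Fin d) → ℂ) =
      fun v => Complex.exp (-b * (‖v‖ : ℂ) ^ 2) := by
    ext v
    rw [schwartzGaussian_apply hb]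
    push_cast
    rfl
  rw [fourier_coe, hfun, h, smul_apply, schwartzGaussian_apply (by positivity), smul_eq_mul,
    Complex.ofReal_cpow (by positivity), finrank_euclideanSpace_fin]
  push_cast
  congr 2
  ring

lemma norm_schwartzGaussian_rpow {b : ℝ} (hb : 0 < b) (x : EuclideanSpace ℝ (Fin d)) :
    ‖schwartzGaussian d b x‖ ^ p = Real.exp (-(p * b) * ‖x‖ ^ 2) := by
  rw [schwartzGaussian_apply hb, Complex.norm_real, Real.norm_of_nonneg (Real.exp_pos _).le,
    ← Real.exp_mul]
  congr 1
  ring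

lemma fourier_schwartzGaussian_pi : 𝓕 (schwartzGaussian d Real.pi) = schwartzGaussian d Real.pi := by
  rw [fourier_schwartzGaussian Real.pi_pos, div_self Real.pi_ne_zero, Real.one_rpow, sq,
    mul_div_cancel_right₀ _ Real.pi_ne_zero]
  simp

lemma schwartzGaussian_ne_zero {b : ℝ} (hb : 0 < b) : schwartzGaussian d b ≠ 0 := fun h => by
  have := schwartzGaussian_apply hb (0 : EuclideanSpace ℝ (Fin d))
  rw [h] at this
  simp at this

/-- With `t = ‖x‖²/d`, `t^(p/2) ≤ 1 + t ≤ 1 + e^t` as `p ≤ 2`. The factor `e^t` only lowers the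
Gaussian exponent by `1/d`, which costs at most `(e^(1/d))^(d/2) = e^(1/2)` in the integral. -/
lemma moment_schwartzGaussian_pi_le (hd : 1 ≤ d) (hp : 1 < p) (hp2 : p ≤ 2) :
    moment p (schwartzGaussian d Real.pi) ≤
      (d : ℝ) ^ (p / 2) * ((1 + Real.exp 1) * lpPow p (schwartzGaussian d Real.pi)) := by
  have hd1 : (1 : ℝ) ≤ d := by exact_mod_cast hd
  have hd0 : (0 : ℝ) < d := by linarith
  have hp0 : 0 < p := by linarith
  set ε : ℝ := 1 / d with hε
  have hε0 : 0 < ε := by positivity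
  have hε1 : ε ≤ 1 := by rw [hε, div_le_one hd0]; exact hd1
  have hpi : 2 ≤ p * Real.pi := by nlinarith [Real.pi_gt_three]
  have hpos : 1 ≤ p * Real.pi - ε := by linarith
  have hpos0 : 0 < p * Real.pi - ε := by linarith
  have hi1 := integrable_exp_neg_mul_norm_sq (d := d) (b := p * Real.pi) (by linarith)
  have hi2 := integrable_exp_neg_mul_norm_sq (d := d) (b := p * Real.pi - ε) hpos0
  have hN : lpPow p (schwartzGaussian d Real.pi) =
      ∫ x : EuclideanSpace ℝ (Fin d), Real.exp (-(p * Real.pi) * ‖x‖ ^ 2) := by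
    simp only [lpPow, norm_schwartzGaussian_rpow Real.pi_pos]
  have h2 : ∫ x : EuclideanSpace ℝ (Fin d), Real.exp (-(p * Real.pi - ε) * ‖x‖ ^ 2) ≤
      Real.exp 1 * lpPow p (schwartzGaussian d Real.pi) := by
    rw [hN, GaussianFourier.integral_rexp_neg_mul_sq_norm hpos0,
      GaussianFourier.integral_rexp_neg_mul_sq_norm (by linarith), finrank_euclideanSpace_fin]
    have h3 : Real.pi / (p * Real.pi - ε) ≤ Real.exp ε * (Real.pi / (p * Real.pi)) := by
      have h4 : p * Real.pi / (p * Real.pi - ε) ≤ Real.exp ε := by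
        refine le_trans ?_ (Real.add_one_le_exp ε)
        rw [div_le_iff₀ hpos0]
        nlinarith
      calc _ = p * Real.pi / (p * Real.pi - ε) * (Real.pi / (p * Real.pi)) := by
            have := Real.pi_pos
            field_simp
        _ ≤ _ := by have := Real.pi_pos; gcongr
    calc _ ≤ (Real.exp ε * (Real.pi / (p * Real.pi))) ^ ((d : ℝ) / 2) := by
          have := Real.pi_pos
          gcongr
      _ = Real.exp (1 / 2) * (Real.pi / (p * Real.pi)) ^ ((d : ℝ) / 2) := by
          have := Real.pi_pos
          rw [Real.mul_rpow (by positivity) (by positivity), ← Real.exp_mul]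
          congr 2
          rw [hε]; field_simp
      _ ≤ _ := by
          have := Real.pi_pos
          gcongr
          norm_num
  have hpt : ∀ x : EuclideanSpace ℝ (Fin d), ‖x‖ ^ p * ‖schwartzGaussian d Real.pi x‖ ^ p ≤
      (d : ℝ) ^ (p / 2) * (Real.exp (-(p * Real.pi) * ‖x‖ ^ 2) +
        Real.exp (-(p * Real.pi - ε) * ‖x‖ ^ 2)) := fun x => by
    rw [norm_schwartzGaussian_rpow Real.pi_pos]
    set t := ε * ‖x‖ ^ 2 with ht
    have ht0 : 0 ≤ t := by positivity
    have h5 : t ^ (p / 2) ≤ 1 + t := by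
      rcases le_total t 1 with h | h
      · have := Real.rpow_le_one ht0 h (by positivity : 0 ≤ p / 2)
        linarith
      · calc t ^ (p / 2) ≤ t ^ (1 : ℝ) := Real.rpow_le_rpow_of_exponent_le h (by linarith)
          _ ≤ 1 + t := by rw [Real.rpow_one]; linarith
    have h6 : ‖x‖ ^ p = (d : ℝ) ^ (p / 2) * t ^ (p / 2) := by
      rw [← Real.mul_rpow hd0.le ht0, ht, hε, ← mul_assoc, mul_one_div_cancel hd0.ne', one_mul,
        ← Real.rpow_natCast, ← Real.rpow_mul (norm_nonneg x)]
      congr 1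
      push_cast
      ring
    have h7 : 1 + t ≤ 1 + Real.exp t := by linarith [Real.add_one_le_exp t]
    rw [h6, mul_assoc]
    gcongr
    calc _ ≤ (1 + Real.exp t) * Real.exp (-(p * Real.pi) * ‖x‖ ^ 2) := by
          gcongr
          exact h5.trans h7
      _ = _ := by
          rw [add_mul, one_mul, ← Real.exp_add]
          congr 2
          rw [ht]; ring
  calc _ ≤ ∫ x : EuclideanSpace ℝ (Fin d), (d : ℝ) ^ (p / 2) *
        (Real.exp (-(p * Real.pi) * ‖x‖ ^ 2) + Real.exp (-(p * Real.pi - ε) * ‖x‖ ^ 2)) :=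
        integral_mono ((schwartzGaussian d Real.pi).integrable_norm_rpow_mul hp0)
          ((hi1.add hi2).const_mul _) hpt
    _ = (d : ℝ) ^ (p / 2) * (lpPow p (schwartzGaussian d Real.pi) +
        ∫ x : EuclideanSpace ℝ (Fin d), Real.exp (-(p * Real.pi - ε) * ‖x‖ ^ 2)) := by
        rw [integral_const_mul, integral_add hi1 hi2, hN]
    _ ≤ _ := by
        gcongr
        linarith

theorem uncertaintyProduct_schwartzGaussian_pi_le (hd : 1 ≤ d) (hp : 1 < p) (hp2 : p ≤ 2) :
    uncertaintyProduct p (schwartzGaussian d Real.pi) ≤ (1 + Real.exp 1) ^ 2 * (d : ℝ) ^ p := by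
  have hd0 : (0 : ℝ) < d := by exact_mod_cast hd
  have hN := lpPow_pos (schwartzGaussian_ne_zero (d := d) Real.pi_pos) (by linarith : 0 < p)
  have h : moment p (schwartzGaussian d Real.pi) / lpPow p (schwartzGaussian d Real.pi) ≤
      (1 + Real.exp 1) * (d : ℝ) ^ (p / 2) := by
    rw [div_le_iff₀ hN]
    linarith [moment_schwartzGaussian_pi_le hd hp hp2]
  have h0 : 0 ≤ moment p (schwartzGaussian d Real.pi) / lpPow p (schwartzGaussian d Real.pi) :=
    div_nonneg (moment_nonneg _) hN.le
  rw [uncertaintyProduct_eq, fourier_schwartzGaussian_pi]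
  calc _ ≤ ((1 + Real.exp 1) * (d : ℝ) ^ (p / 2)) * ((1 + Real.exp 1) * (d : ℝ) ^ (p / 2)) := by
        gcongr
    _ = (1 + Real.exp 1) ^ 2 * ((d : ℝ) ^ (p / 2) * (d : ℝ) ^ (p / 2)) := by ring
    _ = _ := by rw [← Real.rpow_add hd0, add_halves]

end Gaussian

/-! ### The self-dual pair and the vanishing infimum. -/

section GaussianPair

variable {d : ℕ} {p : ℝ}

lemma moment_smul (a : ℂ) (f : 𝓢(EuclideanSpace ℝ (Fin d), ℂ)) :
    moment p (a • f) = ‖a‖ ^ p * moment p f := by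
  rw [moment, moment, ← integral_const_mul]
  congr 1 with x
  rw [smul_apply, norm_smul, Real.mul_rpow (norm_nonneg _) (norm_nonneg _)]
  ring

lemma lpPow_smul (a : ℂ) (f : 𝓢(EuclideanSpace ℝ (Fin d), ℂ)) :
    lpPow p (a • f) = ‖a‖ ^ p * lpPow p f := by
  rw [lpPow, lpPow, ← integral_const_mul]
  congr 1 with x
  rw [smul_apply, norm_smul, Real.mul_rpow (norm_nonneg _) (norm_nonneg _)]

lemma schwartzGaussian_apply_scaled {l : ℝ} (hl : 0 < l) (x : EuclideanSpace ℝ (Fin d)) :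
    schwartzGaussian d (Real.pi * l ^ 2) x = schwartzGaussian d Real.pi (l • x) := by
  rw [schwartzGaussian_apply (by positivity), schwartzGaussian_apply Real.pi_pos, norm_smul,
    Real.norm_of_nonneg hl.le]
  congr 2
  ring

lemma lpPow_schwartzGaussian_scaled {l : ℝ} (hl : 0 < l) :
    lpPow p (schwartzGaussian d (Real.pi * l ^ 2)) =
      l ^ (-(d : ℝ)) * lpPow p (schwartzGaussian d Real.pi) := by
  simp only [lpPow, schwartzGaussian_apply_scaled hl]
  rw [Measure.integral_comp_smul_of_nonneg volume
    (fun x => ‖schwartzGaussian d Real.pi x‖ ^ p) l (hR := hl.le), finrank_euclideanSpace_fin,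
    smul_eq_mul, Real.rpow_neg hl.le, Real.rpow_natCast]

lemma moment_schwartzGaussian_scaled {l : ℝ} (hl : 0 < l) :
    moment p (schwartzGaussian d (Real.pi * l ^ 2)) =
      l ^ (-(d : ℝ) - p) * moment p (schwartzGaussian d Real.pi) := by
  have h : ∀ x : EuclideanSpace ℝ (Fin d), ‖x‖ ^ p * ‖schwartzGaussian d (Real.pi * l ^ 2) x‖ ^ p =
      l ^ (-p) * (‖l • x‖ ^ p * ‖schwartzGaussian d Real.pi (l • x)‖ ^ p) := fun x => by
    rw [schwartzGaussian_apply_scaled hl, norm_smul, Real.norm_of_nonneg hl.le,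
      Real.mul_rpow hl.le (norm_nonneg _), ← mul_assoc, ← mul_assoc, ← Real.rpow_add hl]
    simp
  simp only [moment, h]
  rw [integral_const_mul, Measure.integral_comp_smul_of_nonneg volume
    (fun x => ‖x‖ ^ p * ‖schwartzGaussian d Real.pi x‖ ^ p) l (hR := hl.le),
    finrank_euclideanSpace_fin, smul_eq_mul, ← mul_assoc, ← Real.rpow_natCast,
    ← Real.rpow_neg hl.le, ← Real.rpow_add hl]
  congr 2
  ring

/-- The self-dual pair of Gaussians `c^{-d/2} e^{-π|x|²/c²} + c^{d/2} e^{-πc²|x|²}` as a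
Schwartz function. -/
noncomputable def schwartzGaussianPair (d : ℕ) (c : ℝ) : 𝓢(EuclideanSpace ℝ (Fin d), ℂ) :=
  ((c⁻¹ ^ ((d : ℝ) / 2) : ℝ) : ℂ) • schwartzGaussian d (Real.pi * c⁻¹ ^ 2) +
    ((c ^ ((d : ℝ) / 2) : ℝ) : ℂ) • schwartzGaussian d (Real.pi * c ^ 2)

lemma schwartzGaussianPair_apply {c : ℝ} (hc : 0 < c) (x : EuclideanSpace ℝ (Fin d)) :
    schwartzGaussianPair d c x = (gaussianPair d c x : ℝ) := by
  rw [schwartzGaussianPair, add_apply, smul_apply, smul_apply,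
    schwartzGaussian_apply (by positivity), schwartzGaussian_apply (by positivity), gaussianPair,
    neg_div, Real.rpow_neg hc.le, Real.inv_rpow hc.le, smul_eq_mul, smul_eq_mul,
    ← Complex.ofReal_mul, ← Complex.ofReal_mul, ← Complex.ofReal_add,
    show -(Real.pi * c⁻¹ ^ 2) * ‖x‖ ^ 2 = -Real.pi * ‖x‖ ^ 2 / c ^ 2 by field_simp,
    show -(Real.pi * c ^ 2) * ‖x‖ ^ 2 = -Real.pi * c ^ 2 * ‖x‖ ^ 2 by ring]

/-- With the `L^2` normalization `l^(d/2)`, the transform inverts the scale, so it swaps the two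
terms of the pair. -/
lemma fourier_smul_schwartzGaussian {l : ℝ} (hl : 0 < l) :
    𝓕 (((l ^ ((d : ℝ) / 2) : ℝ) : ℂ) • schwartzGaussian d (Real.pi * l ^ 2)) =
      ((l⁻¹ ^ ((d : ℝ) / 2) : ℝ) : ℂ) • schwartzGaussian d (Real.pi * l⁻¹ ^ 2) := by
  have hpi := Real.pi_pos
  rw [FourierTransform.fourier_smul, fourier_schwartzGaussian (by positivity), smul_smul,
    ← Complex.ofReal_mul, ← Real.mul_rpow hl.le (by positivity)]
  congr 4 <;> field_simp

lemma fourier_schwartzGaussianPair {c : ℝ} (hc : 0 < c) :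
    𝓕 (schwartzGaussianPair d c) = schwartzGaussianPair d c := by
  have h := fourier_smul_schwartzGaussian (d := d) (inv_pos.2 hc)
  rw [inv_inv] at h
  rw [schwartzGaussianPair, FourierTransform.fourier_add, h, fourier_smul_schwartzGaussian hc,
    add_comm]

lemma norm_schwartzGaussianPair {c : ℝ} (hc : 0 < c) (x : EuclideanSpace ℝ (Fin d)) :
    ‖schwartzGaussianPair d c x‖ =
      ‖(((c⁻¹ ^ ((d : ℝ) / 2) : ℝ) : ℂ) • schwartzGaussian d (Real.pi * c⁻¹ ^ 2)) x‖ +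
      ‖(((c ^ ((d : ℝ) / 2) : ℝ) : ℂ) • schwartzGaussian d (Real.pi * c ^ 2)) x‖ := by
  rw [schwartzGaussianPair, add_apply, smul_apply, smul_apply,
    schwartzGaussian_apply (by positivity), schwartzGaussian_apply (by positivity), smul_eq_mul,
    smul_eq_mul, ← Complex.ofReal_mul, ← Complex.ofReal_mul, ← Complex.ofReal_add,
    Complex.norm_real, Complex.norm_real, Complex.norm_real, Real.norm_of_nonneg (by positivity),
    Real.norm_of_nonneg (by positivity), Real.norm_of_nonneg (by positivity)]

lemma schwartzGaussianPair_ne_zero {c : ℝ} (hc : 0 < c) : schwartzGaussianPair d c ≠ 0 := fun h => by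
  have h0 := schwartzGaussianPair_apply hc (0 : EuclideanSpace ℝ (Fin d))
  have : 0 < gaussianPair d c 0 := by unfold gaussianPair; positivity
  rw [h, zero_apply] at h0
  exact this.ne (by exact_mod_cast h0)

/-- Both terms are positive, so nothing cancels and the narrow Gaussian alone bounds the mass from
below. -/
lemma le_lpPow_schwartzGaussianPair (hp : 0 < p) {c : ℝ} (hc : 0 < c) :
    c ^ ((d : ℝ) / 2 * p - d) * lpPow p (schwartzGaussian d Real.pi) ≤
      lpPow p (schwartzGaussianPair d c) := by
  have h := lpPow_smul (p := p) ((c ^ ((d : ℝ) / 2) : ℝ) : ℂ)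
    (schwartzGaussian d (Real.pi * c ^ 2))
  rw [lpPow_schwartzGaussian_scaled hc, Complex.norm_real, Real.norm_of_nonneg (by positivity),
    ← Real.rpow_mul hc.le, ← mul_assoc, ← Real.rpow_add hc] at h
  rw [sub_eq_add_neg, ← h]
  refine integral_mono (SchwartzMap.integrable_norm_rpow _ hp)
    (SchwartzMap.integrable_norm_rpow _ hp) fun x => ?_
  dsimp only
  rw [norm_schwartzGaussianPair hc]
  gcongr
  exact le_add_of_nonneg_left (norm_nonneg _)

lemma moment_schwartzGaussianPair_le (hp : 0 < p) {c : ℝ} (hc : 0 < c) :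
    moment p (schwartzGaussianPair d c) ≤ 2 ^ p *
      ((c ^ (-((d : ℝ) / 2) * p + d + p) + c ^ ((d : ℝ) / 2 * p - d - p)) *
        moment p (schwartzGaussian d Real.pi)) := by
  have h1 := moment_smul (p := p) ((c⁻¹ ^ ((d : ℝ) / 2) : ℝ) : ℂ)
    (schwartzGaussian d (Real.pi * c⁻¹ ^ 2))
  have h2 := moment_smul (p := p) ((c ^ ((d : ℝ) / 2) : ℝ) : ℂ)
    (schwartzGaussian d (Real.pi * c ^ 2))
  rw [moment_schwartzGaussian_scaled hc, Complex.norm_real, Real.norm_of_nonneg (by positivity),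
    ← Real.rpow_mul hc.le, ← mul_assoc, ← Real.rpow_add hc] at h2
  rw [moment_schwartzGaussian_scaled (inv_pos.2 hc), Complex.norm_real,
    Real.norm_of_nonneg (by positivity), ← Real.rpow_mul (by positivity), ← mul_assoc,
    ← Real.rpow_add (by positivity),
    Real.inv_rpow hc.le ((d : ℝ) / 2 * p + (-d - p)), ← Real.rpow_neg hc.le] at h1
  set A := ((c⁻¹ ^ ((d : ℝ) / 2) : ℝ) : ℂ) • schwartzGaussian d (Real.pi * c⁻¹ ^ 2)
  set B := ((c ^ ((d : ℝ) / 2) : ℝ) : ℂ) • schwartzGaussian d (Real.pi * c ^ 2)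
  have h3 : moment p (schwartzGaussianPair d c) ≤ 2 ^ p * (moment p A + moment p B) := by
    rw [moment, moment, moment, ← integral_add (A.integrable_norm_rpow_mul hp)
      (B.integrable_norm_rpow_mul hp), ← integral_const_mul]
    refine integral_mono (SchwartzMap.integrable_norm_rpow_mul _ hp)
      (((A.integrable_norm_rpow_mul hp).add (B.integrable_norm_rpow_mul hp)).const_mul _) fun x => ?_
    dsimp only
    rw [norm_schwartzGaussianPair hc, ← mul_add, mul_left_comm]
    gcongr
    exact Real.add_rpow_le_two_rpow_mul (norm_nonneg _) (norm_nonneg _) hp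
  refine h3.trans_eq ?_
  rw [h1, h2, ← add_mul]
  congr 4 <;> ring

theorem tendsto_uncertaintyProduct_schwartzGaussianPair (hp : 1 < p)
    (hpd : 2 * (d : ℝ) < p * ((d : ℝ) - 1)) :
    Tendsto (fun c => uncertaintyProduct p (schwartzGaussianPair d c)) atTop (𝓝 0) := by
  have hp0 : 0 < p := by linarith
  set m := moment p (schwartzGaussian d Real.pi) with hm
  set n := lpPow p (schwartzGaussian d Real.pi) with hn
  have hm0 : 0 ≤ m := moment_nonneg _
  have hn0 : 0 < n := lpPow_pos (schwartzGaussian_ne_zero Real.pi_pos) hp0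
  have hratio : Tendsto (fun c => moment p (schwartzGaussianPair d c) /
      lpPow p (schwartzGaussianPair d c)) atTop (𝓝 0) := by
    -- The first power comes from the moment of the wide Gaussian, the second from that of the
    -- narrow one, each divided by the narrow mass. The first decays exactly because `2d < p(d-1)`.
    have hlim : Tendsto (fun c : ℝ => 2 ^ p * (m / n) *
        (c ^ (-(p * ((d : ℝ) - 1) - 2 * d)) + c ^ (-p))) atTop (𝓝 0) := by
      simpa using ((tendsto_rpow_neg_atTop (by linarith : 0 < p * ((d : ℝ) - 1) - 2 * d)).add
        (tendsto_rpow_neg_atTop hp0)).const_mul (2 ^ p * (m / n))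
    refine tendsto_of_tendsto_of_tendsto_of_le_of_le' tendsto_const_nhds hlim
      (Eventually.of_forall fun c => div_nonneg (moment_nonneg _) (lpPow_nonneg _)) ?_
    filter_upwards [eventually_gt_atTop 0] with c hc
    have h1 := moment_schwartzGaussianPair_le (d := d) hp0 hc
    have h2 := le_lpPow_schwartzGaussianPair (d := d) hp0 hc
    have h3 : 0 < c ^ ((d : ℝ) / 2 * p - d) := by positivity
    rw [div_le_iff₀ (lpPow_pos (schwartzGaussianPair_ne_zero hc) hp0)]
    refine h1.trans ?_
    calc _ = 2 ^ p * (m / n) * (c ^ (-(p * ((d : ℝ) - 1) - 2 * d)) + c ^ (-p)) *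
          (c ^ ((d : ℝ) / 2 * p - d) * n) := by
          have e1 : c ^ (-((d : ℝ) / 2) * p + d + p) =
              c ^ (-(p * ((d : ℝ) - 1) - 2 * d)) * c ^ ((d : ℝ) / 2 * p - d) := by
            rw [← Real.rpow_add hc]; congr 1; ring
          have e2 : c ^ ((d : ℝ) / 2 * p - d - p) = c ^ (-p) * c ^ ((d : ℝ) / 2 * p - d) := by
            rw [← Real.rpow_add hc]; congr 1; ring
          rw [e1, e2, ← hm]
          field_simp
      _ ≤ _ := by gcongr
  have h := hratio.mul hratio
  rw [mul_zero] at h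
  refine h.congr' ?_
  filter_upwards [eventually_gt_atTop 0] with c hc
  rw [uncertaintyProduct_eq, fourier_schwartzGaussianPair hc]

end GaussianPair

theorem theorem2 :
    -- the inequality for `1 < p < 2d/(d-1)`, with `C(d,p) = C₁(p) d^p` when `1 < p ≤ 2`
    (∃ C : ℕ → ℝ → ℝ,
      (∀ (d : ℕ) (p : ℝ), 1 ≤ d → 1 < p → p * ((d : ℝ) - 1) < 2 * d →
        0 < C d p ∧
        ∀ f : 𝓢(EuclideanSpace ℝ (Fin d), ℂ), f ≠ 0 → C d p ≤ uncertaintyProduct p f) ∧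
      (∀ p : ℝ, 1 < p → p ≤ 2 →
        ∃ C₁ : ℝ, 0 < C₁ ∧ ∀ d : ℕ, 1 ≤ d → C d p = C₁ * (d : ℝ) ^ p)) ∧
    -- the growth `d^p` is optimal, as the Gaussians show
    (∀ p : ℝ, 1 < p → p ≤ 2 →
      ∃ C₂ : ℝ, 0 < C₂ ∧ ∀ d : ℕ, 1 ≤ d →
        ∃ g : 𝓢(EuclideanSpace ℝ (Fin d), ℂ),
          (∀ x, g x = (Real.exp (-Real.pi * ‖x‖ ^ 2) : ℝ)) ∧
          uncertaintyProduct p g ≤ C₂ * (d : ℝ) ^ p) ∧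
    -- for `p > 2d/(d-1)` the infimum is zero, and it is approached along the self-dual `g_c`
    (∀ (d : ℕ) (p : ℝ), 1 ≤ d → 1 < p → 2 * (d : ℝ) < p * ((d : ℝ) - 1) →
      IsGLB {y : ℝ | ∃ f : 𝓢(EuclideanSpace ℝ (Fin d), ℂ), f ≠ 0 ∧ uncertaintyProduct p f = y} 0 ∧
      ∃ g : ℝ → 𝓢(EuclideanSpace ℝ (Fin d), ℂ),
        (∀ c : ℝ, 0 < c →
          (∀ x, g c x = (gaussianPair d c x : ℝ)) ∧ g c ≠ 0 ∧ 𝓕 (g c) = g c) ∧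
        Tendsto (fun c : ℝ => uncertaintyProduct p (g c)) atTop (𝓝 0)) := by
  refine ⟨?_, fun p hp hp2 => ⟨(1 + Real.exp 1) ^ 2, by positivity, fun d hd =>
    ⟨schwartzGaussian d Real.pi, schwartzGaussian_apply Real.pi_pos,
      uncertaintyProduct_schwartzGaussian_pi_le hd hp hp2⟩⟩, fun d p hd hp hpd => ?_⟩
  · have hbound : ∀ (d : ℕ) (p : ℝ), 1 ≤ d → 2 < p → p * ((d : ℝ) - 1) < 2 * d →
        ∃ C : ℝ, 0 < C ∧ ∀ f : 𝓢(EuclideanSpace ℝ (Fin d), ℂ), f ≠ 0 → C ≤ uncertaintyProduct p f :=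
      fun d p hd hp hpd => exists_uncertaintyProduct_ge_of_two_lt hd hp hpd
    choose! C₀ hC₀ using hbound
    -- Separate formulas are needed because the exponent `(2 - p)⁻¹` of the first is meaningful only
    -- below `2`.
    let C₁ : ℝ → ℝ := fun p => if p < 2 then
      ((1 / 1024) ^ (2 - p)⁻¹ / (2 * Real.pi * Real.exp 1)) ^ p / 4 else 1 / (16 * Real.pi ^ 2)
    have hC₁ : ∀ p, 0 < C₁ p := fun p => by
      dsimp only [C₁]
      have := Real.pi_pos
      split_ifs <;> positivity
    refine ⟨fun d p => if p ≤ 2 then C₁ p * (d : ℝ) ^ p else C₀ d p, fun d p hd hp hpd => ?_,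
      fun p _ hp2 => ⟨C₁ p, hC₁ p, fun d _ => if_pos hp2⟩⟩
    have hd0 : (0 : ℝ) < d := by exact_mod_cast hd
    rcases lt_trichotomy p 2 with h | h | h
    · simp only [h.le, if_true]
      refine ⟨mul_pos (hC₁ p) (by positivity), fun f hf => ?_⟩
      simp only [C₁, h, if_true]
      exact uncertaintyProduct_ge_of_lt_two hd hp h hf
    · subst h
      simp only [le_refl, if_true]
      refine ⟨mul_pos (hC₁ 2) (by positivity), fun f hf => ?_⟩
      simp only [C₁, lt_irrefl, if_false]
      exact uncertaintyProduct_two_ge hd hf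
    · simp only [not_le.2 h, if_false]
      exact hC₀ d p hd h hpd
  · have hlim := tendsto_uncertaintyProduct_schwartzGaussianPair hp hpd
    refine ⟨⟨?_, fun y hy => ?_⟩, schwartzGaussianPair d, fun c hc =>
      ⟨schwartzGaussianPair_apply hc, schwartzGaussianPair_ne_zero hc,
        fourier_schwartzGaussianPair hc⟩, hlim⟩
    · rintro _ ⟨f, -, rfl⟩
      exact uncertaintyProduct_nonneg f
    -- Any lower bound lies below the values along `g_c`, hence below their limit `0`.
    · refine ge_of_tendsto hlim ?_
      filter_upwards [eventually_gt_atTop 0] with c hc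
      exact hy ⟨_, schwartzGaussianPair_ne_zero hc, rfl⟩
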